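/- Conventions. $b\ge 2$ and $b_1,\dots,b_s\ge2$ are integer bases, $s\ge1$, and $\mathbb{Z}_b=\{0,\dots,b-1\}$. *Nets.* For integers $0\le t\le m$, points $a_1,\dots,a_{b^m}\in[0,1]^s$ form a $(t,m,s)$-net in base $b$ if every box $\prod_{j=1}^s[c_jb^{-k_j},(c_j+1)b^{-k_j})$ with integers $k_j\ge0$, $0\le c_j<b^{k_j}$ and volume $b^{t-m}$ contains precisely $b^t$ of the points. *Scrambling.* The random points $u_i=(u_{i1},\dots,u_{is})$ are a nested uniform scramble in base $b$ of points $a_i\in[0,1)^s$ if there are independent, uniformly distributed random permutations $\pi_{j,w}$ of $\mathbb{Z}_b$, one for each $j\in\{1,\dots,s\}$ and each finite word $w$ in $\mathbb{Z}_b$, such that, writing $a_{ij}=\sum_{k\ge1}a_{ij,k}b^{-k}$ (the expansion with no tail of digits $b-1$), one has $u_{ij}=\sum_{k\ge1}\pi_{j,\,a_{ij,1}\cdots a_{ij,k-1}}(a_{ij,k})\,b^{-k}$ for all $i,j$. *Splits.* A $b$-fold split of a set $\mathcal X\subset\mathbb{R}^d$ of finite positive volume is a family of Borel sets $(\mathcal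 X_a)_{a\in\mathbb{Z}_b}$ with $\mathcal X=\bigcup_a\mathcal X_a$, $\mathrm{vol}(\mathcal X_a)=\mathrm{vol}(\mathcal X)/b$ and $\mathrm{vol}(\mathcal X_a\cap\mathcal X_{a'})=0$ for $a\ne a'$. A recursive $b$-fold split of $\mathcal X$ is a family of cells $\mathcal X_{a_1,\dots,a_k}$ ($k\ge0$, $a_i\in\mathbb{Z}_b$), where the cell for $k=0$ is $\mathcal X$ and $(\mathcal X_{a_1,\dots,a_k,a})_{a\in\mathbb{Z}_b}$ is a $b$-fold split of $\mathcal X_{a_1,\dots,a_k}$ for every cell. Sets $S_k\subset\mathbb{R}^d$ converge nicely to $x$ if there are $\alpha<\infty$ and cubes $C_k$ with $x\in C_k$, $S_k\subseteq C_k$, $0<\mathrm{vol}(C_k)\le\alpha\,\mathrm{vol}(S_k)$ for all $k$, and $\mathrm{diam}(S_k)\to0$. The recursive split is convergent if for every infinite sequence $a_1,a_2,\dots\in\mathbb{Z}_b$ the cells $\mathcal X_{a_1,\dots,a_K}$ converge nicely to a point as $K\to\infty$ (this point is then unique). Its transformation $\phi$ sends $x=0.x_1x_2\dots\in[0,1)$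 (base $b$, no tail of digits $b-1$) to the limit of $\mathcal X_{x_1,\dots,x_K}$ as $K\to\infty$. **Theorem.** Let $\mathcal X^{(j)}\subset\mathbb{R}^{d_j}$ with $\mathrm{vol}(\mathcal X^{(j)})=1$ for $j=1,\dots,s$, and let $\mathbb X_j$ be a convergent recursive split of $\mathcal X^{(j)}$ in base $b_j\ge2$ with transformation $\phi_j$. Fix $b\ge2$ and $t\ge0$. Let $u_1,\dots,u_n$ be a nested uniform scramble in base $b$ of a $(t,m,s)$-net in base $b$, with $n=b^m$, and put $x_i=(\phi_1(u_{i1}),\dots,\phi_s(u_{is}))$. Then for every $f\in L^2(\prod_{j=1}^s\mathcal X^{(j)})$ the estimate $\hat\mu=\frac1n\sum_{i=1}^nf(x_i)$ is square integrable, and $$\mathrm{Var}(\hat\mu)=o\Bigl(\frac1n\Bigr)\qquad\text{as } n\to\infty,$$ where the limit is taken along any sequence of such nets with $m\to\infty$, with $f$, $s$, $t$, $b$ and the splits fixed. The bases $b_j$ need not be equal to each other or to $b$. -/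

import Mathlib

open MeasureTheory ProbabilityTheory Filter Topology Asymptotics
open scoped ENNReal NNReal

/-! ### Nets in base `b` -/

/-- The `b`-adic box `∏ⱼ [cⱼ / b ^ kⱼ, (cⱼ + 1) / b ^ kⱼ)` (used with `cⱼ < b ^ kⱼ`). -/
def adicBox {s : ℕ} (b : ℕ) (k c : Fin s → ℕ) : Set (Fin s → ℝ) :=
  {x | ∀ j, (c j : ℝ) / (b : ℝ) ^ k j ≤ x j ∧ x j < ((c j : ℝ) + 1) / (b : ℝ) ^ k j}

/-- `a₁, …, a_{b^m} ∈ [0,1]ˢ` is a `(t,m,s)`-net in base `b`: every `b`-adic box of volume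
`b ^ (t - m)`, that is with `k₁ + ⋯ + kₛ = m - t`, contains precisely `b ^ t` of the points
(counted by index, so with multiplicity). -/
def IsNet (b t m s : ℕ) (a : Fin (b ^ m) → Fin s → ℝ) : Prop :=
  t ≤ m ∧
  (∀ i j, a i j ∈ Set.Icc (0 : ℝ) 1) ∧
  ∀ k c : Fin s → ℕ, (∑ j, k j) + t = m → (∀ j, c j < b ^ k j) →
    {i | a i ∈ adicBox b k c}.ncard = b ^ t

/-! ### Nested uniform scrambles -/

/-- The word `a₁ a₂ … a_K` of the first `K` terms of a digit sequence (the sequence is indexed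
from `0`, so `a 0` is the first digit). -/
def digitPrefix {b : ℕ} (a : ℕ → Fin b) (K : ℕ) : List (Fin b) :=
  List.ofFn fun i : Fin K => a i

/-- Nested scrambling of a digit sequence: each digit is permuted by the permutation attached to
the word of the digits that precede it. -/
def scrambleDigits {b : ℕ} (π : List (Fin b) → Equiv.Perm (Fin b)) (a : ℕ → Fin b) : ℕ → Fin b :=
  fun k => π (digitPrefix a k) (a k)

/-- The random points `u i`, `i ∈ ι`, on the probability space `(Ω, P)` are a nested uniform
scramble in base `b` of the points `a i`. There are independent uniformly distributed
random permutations `π j w` of `{0, …, b - 1}`, one for each coordinate `j` and each finite word `w`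
of digits, and they are applied (the same ones for all points) to the base `b` digits of the
coordinates of the `a i`. `Real.digits x b` is the expansion of `x ∈ [0,1)` that has no
tail of digits `b - 1`, and `Real.ofDigits` sums a digit sequence. -/
def IsNestedUniformScramble {Ω ι : Type*} [MeasurableSpace Ω] (b : ℕ) [NeZero b] {s : ℕ}
    (P : Measure Ω) (a : ι → Fin s → ℝ) (u : ι → Ω → Fin s → ℝ) : Prop :=
  ∃ π : Fin s → List (Fin b) → Ω → Equiv.Perm (Fin b),
    (∀ j w σ, MeasurableSet {ω | π j w ω = σ}) ∧
    (∀ j w σ, P {ω | π j w ω = σ} = ((Nat.factorial b : ℕ) : ℝ≥0∞)⁻¹) ∧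
    iIndepFun (m := fun _ => ⊤) (fun q : Fin s × List (Fin b) => π q.1 q.2) P ∧
    ∀ i ω j, u i ω j =
      Real.ofDigits (scrambleDigits (fun w => π j w ω) (Real.digits (a i j) b))

/-! ### Splits and their transformations -/

/-- `Y 0, …, Y (b - 1)` is a `b`-fold split of the set `X ⊂ ℝᵈ` (where `X` has finite and positive
volume). -/
def IsSplit {d b : ℕ} (X : Set (EuclideanSpace ℝ (Fin d)))
    (Y : Fin b → Set (EuclideanSpace ℝ (Fin d))) : Prop :=
  (∀ a, MeasurableSet (Y a)) ∧
  X = ⋃ a, Y a ∧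
  (∀ a, volume (Y a) = volume X / (b : ℝ≥0∞)) ∧
  ∀ a a', a ≠ a' → volume (Y a ∩ Y a') = 0

/-- A recursive `b`-fold split of `X`: the cell of level `k` with label `a₁, …, a_k` is
`cell [a₁, …, a_k]`, and every cell is split into `b` cells of the next level. -/
structure RecursiveSplit (d b : ℕ) (X : Set (EuclideanSpace ℝ (Fin d))) where
  /-- the cell with a given label -/
  cell : List (Fin b) → Set (EuclideanSpace ℝ (Fin d))
  cell_nil : cell [] = X
  isSplit_cell : ∀ w, IsSplit (cell w) fun a => cell (w ++ [a])

/-- The closed cube in `ℝᵈ` with lower corner `c` and side `r`. -/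
def cube {d : ℕ} (c : EuclideanSpace ℝ (Fin d)) (r : ℝ) : Set (EuclideanSpace ℝ (Fin d)) :=
  {y | ∀ i, c i ≤ y i ∧ y i ≤ c i + r}

/-- The sets `S k` converge nicely to `x`. -/
def ConvergesNicely {d : ℕ} (S : ℕ → Set (EuclideanSpace ℝ (Fin d)))
    (x : EuclideanSpace ℝ (Fin d)) : Prop :=
  (∃ (α : ℝ≥0) (c : ℕ → EuclideanSpace ℝ (Fin d)) (r : ℕ → ℝ), ∀ k,
    x ∈ cube (c k) (r k) ∧ S k ⊆ cube (c k) (r k) ∧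
    0 < volume (cube (c k) (r k)) ∧
    volume (cube (c k) (r k)) ≤ (α : ℝ≥0∞) * volume (S k)) ∧
  Tendsto (fun k => Metric.diam (S k)) atTop (𝓝 0)

namespace RecursiveSplit

variable {d b : ℕ} {X : Set (EuclideanSpace ℝ (Fin d))}

/-- A recursive split is convergent if the cells along every infinite digit sequence converge
nicely to a point. -/
def Convergent (S : RecursiveSplit d b X) : Prop :=
  ∀ a : ℕ → Fin b, ∃ x, ConvergesNicely (fun K => S.cell (digitPrefix a K)) x

/-- The point to which the cells along the digit sequence `a` converge nicely (it is unique). -/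
noncomputable def limitPoint (S : RecursiveSplit d b X) (hS : S.Convergent) (a : ℕ → Fin b) :
    EuclideanSpace ℝ (Fin d) :=
  (hS a).choose

/-- The transformation of `[0,1)` given by a convergent recursive split: `x = 0.x₁x₂…` in base `b`
(without a tail of digits `b - 1`) goes to the limit of the cells labelled `x₁, …, x_K`. Values
at arguments outside `[0,1)` are irrelevant. -/
noncomputable def transform [NeZero b] (S : RecursiveSplit d b X) (hS : S.Convergent) (x : ℝ) :
    EuclideanSpace ℝ (Fin d) :=
  S.limitPoint hS (Real.digits x b)

end RecursiveSplit

/-- The equal weight estimate `(1/n) ∑ᵢ f (φ (uᵢ))`, with `φ` applied componentwise. -/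
noncomputable def estimate {n s : ℕ} {d : Fin s → ℕ}
    (f : ((j : Fin s) → EuclideanSpace ℝ (Fin (d j))) → ℝ)
    (φ : (j : Fin s) → ℝ → EuclideanSpace ℝ (Fin (d j))) (u : Fin n → Fin s → ℝ) : ℝ :=
  (1 / (n : ℝ)) * ∑ i, f fun j => φ j (u i j)

/-! Scrambling makes the digits of every single point uniform, and each φ_j carries the uniform
distribution on [0,1) to the one on X^(j) (`Convergent.measurePreserving_transform`). So only a
square integrable function H of digit arrays matters: f composed with the φ_j and with summation of
digits. The bases b_j play no further role.

A function F of finitely many digits is a sum of parts F_κ (`resolutionPart`), a multiresolution of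
Haar type: F_κ involves κ_j digits of row j and averages to zero over the last of them. Parts of
different resolution are orthogonal, even at two different scrambled points, because some last digit
of one part is unseen by the other. If |κ| + t ≤ m, the sum of F_κ over the scrambled net is not
random and has no variance. If |κ| + t > m, two points can be correlated only if they share κ_j - 1
digits in every row j, and the net property leaves each point at most b^(t+s) such partners. Hence
the sum over n = b^m points has variance at most b^(t+s) n ∫F² (`variance_sum_le`), however many
digits F involves.

Choose G of finitely many digits with ∫(H - G)² ≤ δ. For large m the net sum of G is constant, so
only H - G contributes. To apply the bound above, H is replaced by some G₁ of finitely many digits,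
so close (δ/n in mean square) that the crude bound n² ∫(H - G₁)² suffices. The sum then has variance
O(nδ), the average O(δ/n), and δ is arbitrary. -/

/-! ### Digit words -/

/-- The number whose base `b` digits are the first `K` terms of `c`, most significant first. -/
def wordValue {b : ℕ} (c : ℕ → Fin b) : ℕ → ℕ
  | 0 => 0
  | K + 1 => b * wordValue c K + c K

theorem wordValue_lt {b : ℕ} (c : ℕ → Fin b) (K : ℕ) : wordValue c K < b ^ K := by
  induction K with
  | zero => simp [wordValue]
  | succ K ih =>
    have h := (c K).isLt
    rw [wordValue, pow_succ']
    nlinarith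

theorem floor_mul_pow_succ_div {b : ℕ} [NeZero b] (x : ℝ) (K : ℕ) :
    ⌊x * (b : ℝ) ^ (K + 1)⌋₊ / b = ⌊x * (b : ℝ) ^ K⌋₊ := by
  have hb : (b : ℝ) ≠ 0 := Nat.cast_ne_zero.2 (NeZero.ne b)
  rw [← Nat.floor_div_natCast]
  congr 1
  field_simp
  ring

theorem digits_eq_iff_floor_eq {b : ℕ} [NeZero b] {x : ℝ} (hx : x ∈ Set.Ico (0 : ℝ) 1)
    (c : ℕ → Fin b) (K : ℕ) :
    (∀ k < K, Real.digits x b k = c k) ↔ ⌊x * (b : ℝ) ^ K⌋₊ = wordValue c K := by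
  induction K with
  | zero => simpa [wordValue] using hx.2
  | succ K ih =>
    rw [Nat.forall_lt_succ_right, ih, ← floor_mul_pow_succ_div, wordValue, Fin.ext_iff]
    simp only [Real.digits, Fin.val_ofNat]
    have h := (c K).isLt
    have h2 := Nat.div_add_mod ⌊x * (b : ℝ) ^ (K + 1)⌋₊ b
    constructor
    · rintro ⟨h3, h4⟩
      rw [← h2, h3, h4]
    · intro h3
      rw [h3]
      exact ⟨by rw [Nat.mul_add_div (NeZero.pos b), Nat.div_eq_of_lt h, add_zero],
        by rw [Nat.mul_add_mod, Nat.mod_eq_of_lt h]⟩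

theorem floor_mul_pow_eq_iff {b : ℕ} [NeZero b] {x : ℝ} (hx : 0 ≤ x) (K v : ℕ) :
    ⌊x * (b : ℝ) ^ K⌋₊ = v ↔
      x ∈ Set.Ico ((v : ℝ) / (b : ℝ) ^ K) (((v : ℝ) + 1) / (b : ℝ) ^ K) := by
  have hb : (0 : ℝ) < (b : ℝ) ^ K := pow_pos (Nat.cast_pos.2 (NeZero.pos b)) K
  rw [Nat.floor_eq_iff (by positivity), Set.mem_Ico, div_le_iff₀ hb, lt_div_iff₀ hb]

theorem adic_Ico_subset {b : ℕ} [NeZero b] {K v : ℕ} (hv : v < b ^ K) :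
    Set.Ico ((v : ℝ) / (b : ℝ) ^ K) (((v : ℝ) + 1) / (b : ℝ) ^ K) ⊆ Set.Ico 0 1 := by
  have hb : (0 : ℝ) < (b : ℝ) ^ K := pow_pos (Nat.cast_pos.2 (NeZero.pos b)) K
  have hv' : (v : ℝ) + 1 ≤ (b : ℝ) ^ K := by exact_mod_cast hv
  exact fun x hx => ⟨le_trans (by positivity) hx.1,
    hx.2.trans_le ((div_le_one hb).2 hv')⟩

theorem measurable_digits (b : ℕ) [NeZero b] : Measurable fun x : ℝ => Real.digits x b := by
  refine measurable_pi_iff.2 fun k => ?_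
  exact (Measurable.of_discrete (f := fun n : ℕ => Fin.ofNat b n)).comp
    (Nat.measurable_floor.comp (measurable_id.mul_const _))

theorem setOf_digits_eq {b : ℕ} [NeZero b] (c : ℕ → Fin b) (K : ℕ) :
    {x : ℝ | ∀ k < K, Real.digits x b k = c k} ∩ Set.Ico 0 1 =
      Set.Ico ((wordValue c K : ℝ) / (b : ℝ) ^ K) (((wordValue c K : ℝ) + 1) / (b : ℝ) ^ K) := by
  ext x
  constructor
  · rintro ⟨h, hx⟩
    exact (floor_mul_pow_eq_iff hx.1 _ _).1 ((digits_eq_iff_floor_eq hx c K).1 h)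
  · intro h
    have hx := adic_Ico_subset (wordValue_lt c K) h
    exact ⟨(digits_eq_iff_floor_eq hx c K).2 ((floor_mul_pow_eq_iff hx.1 _ _).2 h), hx⟩

/-- Under the uniform distribution on `[0,1)`, each word of `K` digits has probability `b⁻ᴷ`. -/
theorem volume_digits_eq {b : ℕ} [NeZero b] (c : ℕ → Fin b) (K : ℕ) :
    volume.restrict (Set.Ico (0 : ℝ) 1) {x : ℝ | ∀ k < K, Real.digits x b k = c k} =
      ((b : ℝ≥0∞) ^ K)⁻¹ := by
  have hb : (0 : ℝ) < (b : ℝ) ^ K := pow_pos (Nat.cast_pos.2 (NeZero.pos b)) K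
  rw [Measure.restrict_apply' measurableSet_Ico, setOf_digits_eq, Real.volume_Ico, ← sub_div,
    add_sub_cancel_left, one_div, ENNReal.ofReal_inv_of_pos hb, ENNReal.ofReal_pow (by positivity),
    ENNReal.ofReal_natCast]

/-! ### Functions and measures on digit arrays -/

section Arrays

variable {s b : ℕ}

/-- The word of the first `κ j` digits in each row `j`. -/
def restrictWord (κ : Fin s → ℕ) (x : Fin s → ℕ → Fin b) : (j : Fin s) → Fin (κ j) → Fin b :=
  fun j k => x j k

/-- The digit array that continues a word by zeros. -/
def extendWord [NeZero b] (κ : Fin s → ℕ) (c : (j : Fin s) → Fin (κ j) → Fin b) :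
    Fin s → ℕ → Fin b :=
  fun j k => if h : k < κ j then c j ⟨k, h⟩ else 0

/-- The function `ψ` depends only on the first `κ j` digits in each row `j`. -/
def DependsBelow {α : Type*} (κ : Fin s → ℕ) (ψ : (Fin s → ℕ → Fin b) → α) : Prop :=
  ∀ x y, (∀ j, ∀ k < κ j, x j k = y j k) → ψ x = ψ y

theorem DependsBelow.mono {α : Type*} {κ κ' : Fin s → ℕ} {ψ : (Fin s → ℕ → Fin b) → α}
    (h : DependsBelow κ ψ) (hκ : κ ≤ κ') : DependsBelow κ' ψ :=
  fun x y hxy => h x y fun j k hk => hxy j k (hk.trans_le (hκ j))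

theorem DependsBelow.sub {κ : Fin s → ℕ} {ψ ψ' : (Fin s → ℕ → Fin b) → ℝ}
    (h : DependsBelow κ ψ) (h' : DependsBelow κ ψ') : DependsBelow κ (ψ - ψ') := fun x y hxy => by
  simp only [Pi.sub_apply, h x y hxy, h' x y hxy]

theorem dependsBelow_comp_restrictWord {α : Type*} (κ : Fin s → ℕ)
    (ψ : ((j : Fin s) → Fin (κ j) → Fin b) → α) : DependsBelow κ fun x => ψ (restrictWord κ x) :=
  fun x y h => congrArg ψ (by funext j k; exact h j k k.isLt)

theorem measurable_restrictWord (κ : Fin s → ℕ) :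
    Measurable (restrictWord κ : (Fin s → ℕ → Fin b) → _) := by
  refine measurable_pi_iff.2 fun j => measurable_pi_iff.2 fun k => ?_
  exact (measurable_pi_apply _).comp (measurable_pi_apply _)

theorem measurableSet_digits_eq (K : ℕ) (c : Fin s → ℕ → Fin b) :
    MeasurableSet {x : Fin s → ℕ → Fin b | ∀ j, ∀ k < K, x j k = c j k} := by
  have h : ∀ j k, Measurable fun x : Fin s → ℕ → Fin b => x j k := fun j k =>
    (measurable_pi_apply k).comp (measurable_pi_apply j)
  simp only [Set.ofPred_forall]
  exact MeasurableSet.iInter fun j => MeasurableSet.iInter fun k => MeasurableSet.iInter fun _ =>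
    h j k (measurableSet_singleton (c j k))

variable [NeZero b]

theorem restrictWord_eq_iff (κ : Fin s → ℕ) (x : Fin s → ℕ → Fin b)
    (c : (j : Fin s) → Fin (κ j) → Fin b) :
    restrictWord κ x = c ↔ ∀ j, ∀ k < κ j, x j k = extendWord κ c j k := by
  constructor
  · rintro rfl j k hk
    simp [restrictWord, extendWord, hk]
  · intro h
    funext j k
    simp [restrictWord, h j k k.isLt, extendWord]

/-- This reduces such functions to functions on a finite set of words, which makes them measurable
and bounded. -/
theorem DependsBelow.apply_extendWord {α : Type*} {κ : Fin s → ℕ} {ψ : (Fin s → ℕ → Fin b) → α}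
    (h : DependsBelow κ ψ) (x : Fin s → ℕ → Fin b) :
    ψ (extendWord κ (restrictWord κ x)) = ψ x :=
  (h _ _ ((restrictWord_eq_iff κ x _).1 rfl)).symm

theorem tendsto_extendWord_restrictWord (x : Fin s → ℕ → Fin b) :
    Tendsto (fun K : ℕ => extendWord (fun _ => K) (restrictWord (fun _ => K) x)) atTop (𝓝 x) := by
  refine tendsto_pi_nhds.2 fun j => tendsto_pi_nhds.2 fun k => ?_
  refine tendsto_const_nhds.congr' ?_
  filter_upwards [eventually_gt_atTop k] with K hK
  simp [extendWord, restrictWord, hK]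

theorem DependsBelow.measurable {κ : Fin s → ℕ} {ψ : (Fin s → ℕ → Fin b) → ℝ}
    (h : DependsBelow κ ψ) : Measurable ψ := by
  rw [show ψ = (fun c => ψ (extendWord κ c)) ∘ restrictWord κ from
    funext fun x => (h.apply_extendWord x).symm]
  exact Measurable.of_discrete.comp (measurable_restrictWord κ)

theorem DependsBelow.exists_bound {κ : Fin s → ℕ} {ψ : (Fin s → ℕ → Fin b) → ℝ}
    (h : DependsBelow κ ψ) : ∃ C, ∀ x, ‖ψ x‖ ≤ C :=
  ⟨∑ c, ‖ψ (extendWord κ c)‖, fun x => by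
    rw [← h.apply_extendWord x]
    exact Finset.single_le_sum (f := fun c => ‖ψ (extendWord κ c)‖)
      (fun _ _ => norm_nonneg _) (Finset.mem_univ _)⟩

theorem DependsBelow.memLp {κ : Fin s → ℕ} {ψ : (Fin s → ℕ → Fin b) → ℝ}
    (h : DependsBelow κ ψ) {Ω : Type*} [MeasurableSpace Ω] {P : Measure Ω} [IsFiniteMeasure P]
    {Y : Ω → Fin s → ℕ → Fin b} (hY : Measurable Y) (p : ℝ≥0∞) :
    MemLp (fun ω => ψ (Y ω)) p P := by
  obtain ⟨C, hC⟩ := h.exists_bound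
  exact MemLp.of_bound (h.measurable.comp hY).aestronglyMeasurable C (.of_forall fun ω => hC _)

/-- Two finite measures on digit arrays agree if they agree on all words. -/
theorem ext_of_restrictWord {μ ν : Measure (Fin s → ℕ → Fin b)} [IsFiniteMeasure μ]
    [IsFiniteMeasure ν]
    (h : ∀ (K : ℕ) (c : Fin s → ℕ → Fin b),
      μ {x | ∀ j, ∀ k < K, x j k = c j k} = ν {x | ∀ j, ∀ k < K, x j k = c j k}) : μ = ν := by
  have hmap : ∀ K : ℕ, μ.map (restrictWord fun _ => K) = ν.map (restrictWord fun _ => K) := by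
    intro K
    refine Measure.ext_of_singleton fun c => ?_
    rw [Measure.map_apply (measurable_restrictWord _) (measurableSet_singleton _),
      Measure.map_apply (measurable_restrictWord _) (measurableSet_singleton _)]
    have : restrictWord (fun _ => K) ⁻¹' {c} =
        {x : Fin s → ℕ → Fin b | ∀ j, ∀ k < K, x j k = extendWord (fun _ => K) c j k} := by
      ext x
      exact restrictWord_eq_iff _ x c
    rw [this, h]
  refine ext_of_forall_integral_eq_of_IsFiniteMeasure fun g => ?_
  -- Arrays truncated to `K` digits and padded by zeros converge pointwise to the original, so the
  -- integral of a bounded continuous function is a limit of integrals over words.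
  have key : ∀ ρ : Measure (Fin s → ℕ → Fin b), IsFiniteMeasure ρ →
      Tendsto (fun K : ℕ => ∫ c, g (extendWord (fun _ => K) c) ∂(ρ.map (restrictWord fun _ => K)))
        atTop (𝓝 (∫ x, g x ∂ρ)) := by
    intro ρ hρ
    have : ∀ K : ℕ, ∫ c, g (extendWord (fun _ => K) c) ∂(ρ.map (restrictWord fun _ => K)) =
        ∫ x, g (extendWord (fun _ => K) (restrictWord (fun _ => K) x)) ∂ρ := fun K =>
      integral_map (measurable_restrictWord _).aemeasurable
        Measurable.of_discrete.aestronglyMeasurable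
    simp_rw [this]
    refine tendsto_integral_of_dominated_convergence (fun _ => ‖g‖) (fun K => ?_)
      (integrable_const _) (fun K => .of_forall fun x => g.norm_coe_le_norm _)
      (.of_forall fun x => (g.continuous.tendsto _).comp (tendsto_extendWord_restrictWord x))
    exact (Measurable.of_discrete (f := fun c => g (extendWord (fun _ => K) c))).comp
      (measurable_restrictWord _) |>.aestronglyMeasurable
  refine tendsto_nhds_unique (key μ inferInstance) ?_
  simp_rw [hmap]
  exact key ν inferInstance

/-- The distribution of the digits of a uniformly distributed point of the unit cube. -/
noncomputable def uniformDigits (s b : ℕ) [NeZero b] : Measure (Fin s → ℕ → Fin b) :=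
  (Measure.pi fun _ : Fin s => volume.restrict (Set.Ico (0 : ℝ) 1)).map
    fun x j => Real.digits (x j) b

instance isProbabilityMeasure_volume_Ico :
    IsProbabilityMeasure (volume.restrict (Set.Ico (0 : ℝ) 1)) :=
  ⟨by simp⟩

theorem measurable_digits_pi (s b : ℕ) [NeZero b] :
    Measurable fun (x : Fin s → ℝ) j => Real.digits (x j) b :=
  measurable_pi_iff.2 fun j => (measurable_digits b).comp (measurable_pi_apply j)

instance : IsProbabilityMeasure (uniformDigits s b) :=
  Measure.isProbabilityMeasure_map (measurable_digits_pi s b).aemeasurable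

theorem uniformDigits_apply (K : ℕ) (c : Fin s → ℕ → Fin b) :
    uniformDigits s b {x | ∀ j, ∀ k < K, x j k = c j k} = (((b : ℝ≥0∞) ^ K)⁻¹) ^ s := by
  rw [uniformDigits, Measure.map_apply (measurable_digits_pi s b) (measurableSet_digits_eq K c)]
  have : (fun (x : Fin s → ℝ) j => Real.digits (x j) b) ⁻¹' {x | ∀ j, ∀ k < K, x j k = c j k} =
      Set.univ.pi fun j => {x : ℝ | ∀ k < K, Real.digits x b k = c j k} := by
    ext x
    simp
  rw [this, Measure.pi_pi]
  simp_rw [volume_digits_eq]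
  simp

/-- Summing uniform digits gives a uniform point of the unit cube. -/
theorem measurePreserving_ofDigits (hb : 2 ≤ b) :
    MeasurePreserving (fun (x : Fin s → ℕ → Fin b) j => Real.ofDigits (x j)) (uniformDigits s b)
      (Measure.pi fun _ : Fin s => volume.restrict (Set.Ico (0 : ℝ) 1)) := by
  have hm : Measurable fun (x : Fin s → ℕ → Fin b) j => Real.ofDigits (x j) :=
    measurable_pi_iff.2 fun j => Real.continuous_ofDigits.measurable.comp (measurable_pi_apply j)
  refine ⟨hm, ?_⟩
  rw [uniformDigits, Measure.map_map hm (measurable_digits_pi s b)]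
  conv_rhs => rw [← Measure.map_id (μ := Measure.pi fun _ : Fin s => volume.restrict _)]
  refine Measure.map_congr ?_
  have : ∀ᵐ x ∂(Measure.pi fun _ : Fin s => volume.restrict (Set.Ico (0 : ℝ) 1)),
      ∀ j, x j ∈ Set.Ico (0 : ℝ) 1 :=
    eventually_all.2 fun j => Measure.tendsto_eval_ae_ae (i := j)
      (ae_restrict_mem measurableSet_Ico)
  filter_upwards [this] with x hx
  funext j
  exact Real.ofDigits_digits hb (hx j)

end Arrays

/-! ### The transformation of a convergent recursive split preserves volume -/

theorem digitPrefix_succ {b : ℕ} (a : ℕ → Fin b) (K : ℕ) :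
    digitPrefix a (K + 1) = digitPrefix a K ++ [a K] := by
  rw [digitPrefix, List.ofFn_succ', List.concat_eq_append]
  rfl

theorem length_digitPrefix {b : ℕ} (a : ℕ → Fin b) (K : ℕ) : (digitPrefix a K).length = K := by
  simp [digitPrefix]

theorem digitPrefix_eq_iff {b : ℕ} (a a' : ℕ → Fin b) (K : ℕ) :
    digitPrefix a K = digitPrefix a' K ↔ ∀ k < K, a k = a' k := by
  simp [digitPrefix, List.ofFn_inj, funext_iff, Fin.forall_iff]

theorem volume_cube {d : ℕ} (c : EuclideanSpace ℝ (Fin d)) (r : ℝ) :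
    volume (cube c r) = ENNReal.ofReal r ^ d := by
  have h : cube c r = WithLp.ofLp ⁻¹' (Set.Icc (fun i => c i) fun i => c i + r) := by
    ext y
    simp [cube, Pi.le_def, forall_and]
  rw [h, (PiLp.volume_preserving_ofLp (Fin d)).measure_preimage
    measurableSet_Icc.nullMeasurableSet]
  simp [Real.volume_Icc_pi]

/-- The enclosing cubes have volume at most α times that of the sets, so their sides shrink to zero,
and they all contain the limit point. -/
theorem ConvergesNicely.eventually_subset_closedBall {d : ℕ}
    {S : ℕ → Set (EuclideanSpace ℝ (Fin d))} {x : EuclideanSpace ℝ (Fin d)}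
    (h : ConvergesNicely S x) (hv : Tendsto (fun k => volume (S k)) atTop (𝓝 0)) {ε : ℝ}
    (hε : 0 < ε) : ∀ᶠ k in atTop, S k ⊆ Metric.closedBall x ε := by
  -- For d = 0 the volume r^d does not control r, but the space is a single point.
  rcases Nat.eq_zero_or_pos d with rfl | hd
  · refine .of_forall fun k y _ => ?_
    rw [Subsingleton.elim y x]
    exact Metric.mem_closedBall_self hε.le
  obtain ⟨⟨α, c, r, hc⟩, -⟩ := h
  have hd' : (1 : ℝ) ≤ d := by exact_mod_cast hd
  -- Coordinates within δ give Euclidean distance at most √d δ ≤ d δ = ε.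
  set δ : ℝ := ε / d with hδ
  have hδ0 : 0 < δ := by positivity
  have hv' : Tendsto (fun k => (α : ℝ≥0∞) * volume (S k)) atTop (𝓝 0) := by
    simpa using ENNReal.Tendsto.const_mul hv (.inr ENNReal.coe_ne_top)
  have hpos : 0 < ENNReal.ofReal δ ^ d := ENNReal.pow_pos (ENNReal.ofReal_pos.2 hδ0) _
  filter_upwards [hv'.eventually (gt_mem_nhds hpos)] with k hk y hy
  obtain ⟨hxc, hsub, -, hle⟩ := hc k
  have hyc := hsub hy
  rw [volume_cube] at hle
  have hr : r k < δ :=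
    (ENNReal.ofReal_lt_ofReal_iff hδ0).1 ((ENNReal.pow_lt_pow_left_iff hd.ne').1 (hle.trans_lt hk))
  rw [Metric.mem_closedBall, EuclideanSpace.dist_eq]
  refine Real.sqrt_le_iff.2 ⟨hε.le, ?_⟩
  have hi : ∀ i, dist (y i) (x i) ^ 2 ≤ δ ^ 2 := fun i => by
    have h1 := hyc i
    have h2 := hxc i
    have h3 : dist (y i) (x i) ≤ δ := by
      rw [Real.dist_eq, abs_le]
      constructor <;> linarith
    exact pow_le_pow_left₀ dist_nonneg h3 2
  calc ∑ i, dist (y i) (x i) ^ 2 ≤ ∑ _i : Fin d, δ ^ 2 := Finset.sum_le_sum fun i _ => hi i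
    _ = d * δ ^ 2 := by simp
    _ ≤ d * (d * δ ^ 2) := le_mul_of_one_le_left (by positivity) hd'
    _ = ε ^ 2 := by rw [hδ]; field_simp

namespace RecursiveSplit

variable {d b : ℕ} {X : Set (EuclideanSpace ℝ (Fin d))} (S : RecursiveSplit d b X)

theorem volume_cell (hX : volume X = 1) (w : List (Fin b)) :
    volume (S.cell w) = ((b : ℝ≥0∞) ^ w.length)⁻¹ := by
  induction w using List.reverseRecOn with
  | nil => simp [S.cell_nil, hX]
  | append_singleton w a ih =>
    rw [(S.isSplit_cell w).2.2.1 a, ih, List.length_append, List.length_singleton, pow_succ,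
      ENNReal.mul_inv (.inr (ENNReal.natCast_ne_top b)) (.inl (by simp [ENNReal.pow_eq_top_iff])),
      div_eq_mul_inv]

variable {S} in
theorem Convergent.eventually_cell_subset (hX : volume X = 1) (hb : 2 ≤ b) (hS : S.Convergent)
    (a : ℕ → Fin b) {ε : ℝ} (hε : 0 < ε) :
    ∀ᶠ K in atTop, S.cell (digitPrefix a K) ⊆ Metric.closedBall (S.limitPoint hS a) ε := by
  refine (hS a).choose_spec.eventually_subset_closedBall ?_ hε
  simp_rw [S.volume_cell hX, length_digitPrefix, ENNReal.inv_pow]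
  exact ENNReal.tendsto_pow_atTop_nhds_zero_of_lt_one
    (ENNReal.inv_lt_one.2 (by exact_mod_cast hb))

theorem setIntegral_cell {g : EuclideanSpace ℝ (Fin d) → ℝ} (w : List (Fin b))
    (hg : IntegrableOn g (S.cell w)) :
    ∫ y in S.cell w, g y = ∑ a, ∫ y in S.cell (w ++ [a]), g y := by
  obtain ⟨hm, hU, -, hd⟩ := S.isSplit_cell w
  rw [hU] at hg ⊢
  rw [integral_iUnion_ae (fun a => (hm a).nullMeasurableSet) (fun a a' h => hd a a' h) hg,
    tsum_fintype]

theorem sum_setIntegral_cell {g : EuclideanSpace ℝ (Fin d) → ℝ}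
    (hg : ∀ w, IntegrableOn g (S.cell w)) (K : ℕ) :
    ∑ c : Fin K → Fin b, ∫ y in S.cell (List.ofFn c), g y = ∫ y in X, g y := by
  induction K with
  | zero => simp [S.cell_nil]
  | succ K ih =>
    rw [← ih, ← (Fin.snocEquiv fun _ : Fin (K + 1) => Fin b).sum_comp, Fintype.sum_prod_type_right]
    refine Finset.sum_congr rfl fun c _ => ?_
    rw [S.setIntegral_cell _ (hg _)]
    refine Finset.sum_congr rfl fun a _ => ?_
    rw [List.ofFn_succ', List.concat_eq_append]
    simp [Fin.snocEquiv]

variable [NeZero b]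

theorem integral_digits (K : ℕ) (ψ : (Fin K → Fin b) → ℝ) :
    ∫ x in Set.Ico (0 : ℝ) 1, ψ (fun k => Real.digits x b k) =
      ∑ c, ((b : ℝ) ^ K)⁻¹ * ψ c := by
  have hm : Measurable fun (x : ℝ) (k : Fin K) => Real.digits x b k :=
    measurable_pi_iff.2 fun k => (measurable_pi_apply _).comp (measurable_digits b)
  rw [← integral_map (f := ψ) hm.aemeasurable Measurable.of_discrete.aestronglyMeasurable]
  have := Measure.isProbabilityMeasure_map (μ := volume.restrict (Set.Ico (0 : ℝ) 1)) hm.aemeasurable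
  rw [integral_fintype (Integrable.of_finite)]
  refine Finset.sum_congr rfl fun c _ => ?_
  rw [smul_eq_mul, Measure.real, Measure.map_apply hm (measurableSet_singleton c)]
  have h := volume_digits_eq (fun k => if h : k < K then c ⟨k, h⟩ else 0) K
  have h2 : (fun (x : ℝ) (k : Fin K) => Real.digits x b k) ⁻¹' {c} =
      {x : ℝ | ∀ k < K, Real.digits x b k = if h : k < K then c ⟨k, h⟩ else 0} := by
    ext x
    simp only [Set.mem_preimage, Set.mem_singleton_iff, funext_iff, Fin.forall_iff, Set.mem_ofPred_eq]
    exact forall₂_congr fun k hk => by rw [dif_pos hk]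
  rw [h2, h]
  simp

variable {S} in
-- The transformation is the pointwise limit of functions of finitely many digits: any choice of one
-- point per cell.
theorem Convergent.measurable_transform (hX : volume X = 1) (hb : 2 ≤ b) (hS : S.Convergent) :
    Measurable (S.transform hS) := by
  have hne : ∀ w, (S.cell w).Nonempty := fun w => by
    refine nonempty_of_measure_ne_zero (μ := volume) ?_
    rw [S.volume_cell hX]
    simp [ENNReal.pow_eq_top_iff]
  choose p hp using hne
  refine measurable_of_tendsto_metrizable
    (f := fun (K : ℕ) (x : ℝ) => p (digitPrefix (Real.digits x b) K)) (fun K => ?_) ?_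
  · have hm : Measurable fun (x : ℝ) (k : Fin K) => Real.digits x b k :=
      measurable_pi_iff.2 fun k => (measurable_pi_apply _).comp (measurable_digits b)
    exact (Measurable.of_discrete (f := fun c : Fin K → Fin b => p (List.ofFn c))).comp hm
  · refine tendsto_pi_nhds.2 fun x => Metric.tendsto_nhds.2 fun ε hε => ?_
    filter_upwards [hS.eventually_cell_subset hX hb (Real.digits x b) (half_pos hε)] with K hK
    exact (hK (hp _)).trans_lt (half_lt_self hε)

variable {S} in
/-- The transformation sends the uniform distribution on `[0,1)` to the one on `X`. -/
theorem Convergent.measurePreserving_transform (hX : volume X = 1) (hb : 2 ≤ b)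
    (hS : S.Convergent) :
    MeasurePreserving (S.transform hS) (volume.restrict (Set.Ico (0 : ℝ) 1))
      (volume.restrict X) := by
  have hmeas := hS.measurable_transform hX hb
  refine ⟨hmeas, ?_⟩
  have : IsProbabilityMeasure (volume.restrict X) := ⟨by simp [hX]⟩
  have hbpos : (0 : ℝ) < b := by positivity
  have hvol : ∀ w, volume.real (S.cell w) = ((b : ℝ) ^ w.length)⁻¹ := fun w => by
    simp [Measure.real, S.volume_cell hX]
  have hfin : ∀ w, volume (S.cell w) ≠ ∞ := fun w => by
    rw [S.volume_cell hX]
    simp [NeZero.ne b]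
  refine ext_of_forall_integral_eq_of_IsFiniteMeasure fun g => ?_
  have hg : ∀ w, IntegrableOn g (S.cell w) := fun w => by
    have : IsFiniteMeasure (volume.restrict (S.cell w)) := ⟨by simpa using (hfin w).lt_top⟩
    exact g.integrable _
  rw [integral_map hmeas.aemeasurable g.continuous.measurable.aestronglyMeasurable]
  -- The average of `g` over a cell of level `K`. Its mean over uniform digits is exactly ∫_X g,
  -- while along the digits of x it tends to g at the transform of x.
  let h : (K : ℕ) → (Fin K → Fin b) → ℝ := fun K c => (b : ℝ) ^ K * ∫ y in S.cell (List.ofFn c), g y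
  have hint : ∀ K, ∫ x in Set.Ico (0 : ℝ) 1, h K (fun k => Real.digits x b k) = ∫ y in X, g y := by
    intro K
    rw [integral_digits, ← S.sum_setIntegral_cell hg K]
    refine Finset.sum_congr rfl fun c _ => ?_
    have : (b : ℝ) ^ K ≠ 0 := by positivity
    simp only [h]
    field_simp
  -- Used with `C = 0` for the dominating bound, and with `C` the value of `g` at the limit point
  -- for convergence.
  have hdev : ∀ (K : ℕ) (a : ℕ → Fin b) (C η : ℝ),
      (∀ y ∈ S.cell (digitPrefix a K), ‖g y - C‖ ≤ η) → ‖h K (fun k => a k) - C‖ ≤ η := by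
    intro K a C η hC
    have h1 := norm_setIntegral_le_of_norm_le_const (μ := volume) (hfin (digitPrefix a K)).lt_top hC
    rw [integral_sub (hg _) (integrableOn_const (hfin _)), setIntegral_const, hvol,
      length_digitPrefix] at h1
    have hK : (0 : ℝ) < (b : ℝ) ^ K := by positivity
    have h2 : h K (fun k => a k) - C = (b : ℝ) ^ K *
        ((∫ y in S.cell (digitPrefix a K), g y) - ((b : ℝ) ^ K)⁻¹ • C) := by
      simp only [h, digitPrefix, smul_eq_mul]
      field_simp
    rw [h2, norm_mul, Real.norm_of_nonneg hK.le]
    calc (b : ℝ) ^ K * _ ≤ (b : ℝ) ^ K * (η * ((b : ℝ) ^ K)⁻¹) := by gcongr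
      _ = η := by field_simp
  refine tendsto_nhds_unique (f := fun K => ∫ x in Set.Ico (0 : ℝ) 1, h K fun k => Real.digits x b k)
    (l := atTop) ?_ (by simp_rw [hint]; exact tendsto_const_nhds)
  refine tendsto_integral_of_dominated_convergence (fun _ => ‖g‖) (fun K => ?_)
      (integrable_const _) (fun K => .of_forall fun x => ?_) (.of_forall fun x => ?_)
  · have hm : Measurable fun (x : ℝ) (k : Fin K) => Real.digits x b k :=
      measurable_pi_iff.2 fun k => (measurable_pi_apply _).comp (measurable_digits b)
    exact ((Measurable.of_discrete (f := h K)).comp hm).aestronglyMeasurable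
  · simpa using hdev K (Real.digits x b) 0 ‖g‖ fun y _ => by simpa using g.norm_coe_le_norm y
  · refine Metric.tendsto_nhds.2 fun ε hε => ?_
    obtain ⟨δ, hδ, hgδ⟩ := Metric.continuous_iff.1 g.continuous (S.transform hS x) (ε / 2)
      (half_pos hε)
    filter_upwards [hS.eventually_cell_subset hX hb (Real.digits x b) (half_pos hδ)] with K hK
    rw [dist_eq_norm]
    refine (hdev K (Real.digits x b) _ (ε / 2) fun y hy => ?_).trans_lt (half_lt_self hε)
    rw [← dist_eq_norm]
    exact (hgδ y ((hK hy).trans_lt (half_lt_self hδ))).le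

end RecursiveSplit

/-! ### Counting net points with prescribed digits -/

section Counting

variable {s b : ℕ} {ι : Type*} [Fintype ι]

/-- The number of digit arrays in a family whose first `κ j` digits in row `j` are those of `c`. -/
def agreeCount (A : ι → Fin s → ℕ → Fin b) (κ : Fin s → ℕ) (c : Fin s → ℕ → Fin b) : ℕ :=
  (Finset.univ.filter fun i => ∀ j, ∀ k < κ j, A i j k = c j k).card

theorem agreeCount_anti (A : ι → Fin s → ℕ → Fin b) {κ κ' : Fin s → ℕ} (h : κ ≤ κ')
    (c : Fin s → ℕ → Fin b) : agreeCount A κ' c ≤ agreeCount A κ c := by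
  refine Finset.card_le_card fun i hi => ?_
  rw [Finset.mem_filter] at hi ⊢
  exact ⟨hi.1, fun j k hk => hi.2 j k (hk.trans_le (h j))⟩

theorem sum_agreeCount [NeZero b] (A : ι → Fin s → ℕ → Fin b) (κ : Fin s → ℕ) :
    ∑ c : (j : Fin s) → Fin (κ j) → Fin b, agreeCount A κ (extendWord κ c) = Fintype.card ι := by
  rw [← Finset.card_univ, Finset.card_eq_sum_card_fiberwise (f := fun i => restrictWord κ (A i))
    (t := Finset.univ) (fun _ _ => Finset.mem_coe.2 (Finset.mem_univ _))]
  refine Finset.sum_congr rfl fun c _ => ?_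
  rw [agreeCount]
  congr 1
  ext i
  simp [restrictWord_eq_iff]

/-- Matching arrays are classified by their next digit in row `j`; this passes from longer words to
shorter ones. -/
theorem agreeCount_eq_sum_update (A : ι → Fin s → ℕ → Fin b) (κ : Fin s → ℕ)
    (c : Fin s → ℕ → Fin b) (j : Fin s) :
    agreeCount A κ c = ∑ a : Fin b, agreeCount A (Function.update κ j (κ j + 1))
      (Function.update c j (Function.update (c j) (κ j) a)) := by
  rw [agreeCount, Finset.card_eq_sum_card_fiberwise (f := fun i => A i j (κ j))
    (t := Finset.univ) (fun _ _ => Finset.mem_coe.2 (Finset.mem_univ _))]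
  refine Finset.sum_congr rfl fun a _ => ?_
  rw [agreeCount]
  congr 1
  ext i
  simp only [Finset.mem_filter, Finset.mem_univ, true_and]
  constructor
  · rintro ⟨h, rfl⟩ j' k hk
    by_cases hj : j' = j
    · subst hj
      rw [Function.update_self] at hk ⊢
      by_cases hk' : k = κ j'
      · rw [hk', Function.update_self]
      · rw [Function.update_of_ne hk']
        exact h j' k (by omega)
    · rw [Function.update_of_ne hj] at hk ⊢
      exact h j' k hk
  · intro h
    refine ⟨fun j' k hk => ?_, ?_⟩
    · by_cases hj : j' = j
      · subst hj
        have := h j' k (by rw [Function.update_self]; omega)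
        rwa [Function.update_self, Function.update_of_ne hk.ne] at this
      · have := h j' k (by rwa [Function.update_of_ne hj])
        rwa [Function.update_of_ne hj] at this
    · have := h j (κ j) (by rw [Function.update_self]; omega)
      rwa [Function.update_self, Function.update_self] at this

theorem card_words (κ : Fin s → ℕ) :
    Fintype.card ((j : Fin s) → Fin (κ j) → Fin b) = b ^ ∑ j, κ j := by
  rw [Fintype.card_pi]
  simp [Finset.prod_pow_eq_pow_sum]

/-- The digits of the points of a net are equidistributed over the words of total length `m - t`. -/
theorem IsNet.agreeCount_eq [NeZero b] {t m : ℕ} {a : Fin (b ^ m) → Fin s → ℝ}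
    (ha : IsNet b t m s a) {κ : Fin s → ℕ} (hκ : ∑ j, κ j + t = m) (c : Fin s → ℕ → Fin b) :
    agreeCount (fun i j => Real.digits (a i j) b) κ c = b ^ t := by
  -- Only this inequality is immediate: a coordinate equal to 1 lies in none of these half-open
  -- boxes, yet its `Real.digits` are all 0. Equality follows because both sides have the same total
  -- b^m over all words.
  have hle : ∀ c : Fin s → ℕ → Fin b,
      b ^ t ≤ agreeCount (fun i j => Real.digits (a i j) b) κ c := by
    intro c
    rw [← ha.2.2 κ (fun j => wordValue (c j) (κ j)) hκ fun j => wordValue_lt _ _,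
      agreeCount, ← Set.ncard_coe_finset]
    refine Set.ncard_le_ncard (fun i hi => ?_) (Set.toFinite _)
    simp only [Finset.coe_filter, Finset.mem_univ, true_and]
    intro j
    have h : a i j ∈ Set.Ico ((wordValue (c j) (κ j) : ℝ) / (b : ℝ) ^ κ j)
        (((wordValue (c j) (κ j) : ℝ) + 1) / (b : ℝ) ^ κ j) := hi j
    rw [← setOf_digits_eq] at h
    exact h.1
  have hsum : ∑ c : (j : Fin s) → Fin (κ j) → Fin b, b ^ t =
      ∑ c, agreeCount (fun i j => Real.digits (a i j) b) κ (extendWord κ c) := by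
    rw [sum_agreeCount, Finset.sum_const, Finset.card_univ, card_words, Fintype.card_fin,
      smul_eq_mul, ← pow_add, hκ]
  have h := (Finset.sum_eq_sum_iff_of_le fun c _ => hle (extendWord κ c)).1 hsum
    (restrictWord κ c) (Finset.mem_univ _)
  rw [h, agreeCount, agreeCount]
  congr 1
  ext i
  rw [Finset.mem_filter, Finset.mem_filter, ← restrictWord_eq_iff,
    restrictWord_eq_iff κ _ (restrictWord κ c)]
  refine and_congr_right fun _ => forall_congr' fun j => forall₂_congr fun k hk => ?_
  simp [extendWord, restrictWord, hk]

/-- Each of the `r` missing digits is appended in row `j₀` and contributes a factor b. The row `j₀`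
excludes s = 0, where nothing can be lengthened. -/
theorem IsNet.agreeCount_eq_pow [NeZero b] {t m : ℕ} {a : Fin (b ^ m) → Fin s → ℝ}
    (ha : IsNet b t m s a) (j₀ : Fin s) {r : ℕ} {κ : Fin s → ℕ} (hκ : ∑ j, κ j + t + r = m)
    (c : Fin s → ℕ → Fin b) :
    agreeCount (fun i j => Real.digits (a i j) b) κ c = b ^ (t + r) := by
  induction r generalizing κ c with
  | zero => exact ha.agreeCount_eq hκ c
  | succ r ih =>
    have hsum : ∑ j, Function.update κ j₀ (κ j₀ + 1) j = ∑ j, κ j + 1 := by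
      rw [Finset.sum_update_of_mem (Finset.mem_univ _),
        ← Finset.add_sum_erase _ κ (Finset.mem_univ j₀), Finset.sdiff_singleton_eq_erase]
      ring
    rw [agreeCount_eq_sum_update _ κ c j₀,
      Finset.sum_congr rfl fun x _ => ih (by rw [hsum]; omega) _]
    simp only [Finset.sum_const, Finset.card_univ, Fintype.card_fin, smul_eq_mul]
    rw [← add_assoc, pow_succ']

theorem exists_le_sum_eq (κ : Fin s → ℕ) {n : ℕ} (hn : n ≤ ∑ j, κ j) :
    ∃ κ' ≤ κ, ∑ j, κ' j = n := by
  induction h : ∑ j, κ j - n generalizing κ with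
  | zero => exact ⟨κ, le_rfl, by omega⟩
  | succ r ih =>
    obtain ⟨j, -, hj⟩ : ∃ j ∈ Finset.univ, κ j ≠ 0 :=
      Finset.exists_ne_zero_of_sum_ne_zero (by omega)
    have hsum : ∑ i, Function.update κ j (κ j - 1) i + 1 = ∑ i, κ i := by
      rw [Finset.sum_update_of_mem (Finset.mem_univ _),
        ← Finset.add_sum_erase _ κ (Finset.mem_univ j), Finset.sdiff_singleton_eq_erase]
      omega
    obtain ⟨κ', h1, h2⟩ := ih (Function.update κ j (κ j - 1)) (by omega) (by omega)
    refine ⟨κ', h1.trans (update_le_iff.2 ⟨by omega, fun _ _ => le_rfl⟩), h2⟩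

theorem IsNet.agreeCount_le [NeZero b] {t m : ℕ} {a : Fin (b ^ m) → Fin s → ℝ}
    (ha : IsNet b t m s a) (j₀ : Fin s) {κ : Fin s → ℕ} (hκ : m ≤ ∑ j, κ j + t + s)
    (c : Fin s → ℕ → Fin b) :
    agreeCount (fun i j => Real.digits (a i j) b) κ c ≤ b ^ (t + s) := by
  have htm := ha.1
  -- Shorter words match more points. The truncated difference also covers m - t < s, where the
  -- empty word is used.
  obtain ⟨κ', h1, h2⟩ := exists_le_sum_eq κ (n := m - t - s) (by omega)
  refine (agreeCount_anti _ h1 c).trans ?_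
  rw [ha.agreeCount_eq_pow j₀ (r := m - t - (m - t - s)) (by omega)]
  exact Nat.pow_le_pow_right (NeZero.pos b) (by omega)

end Counting

/-! ### Scrambling permutes words -/

section Scramble

variable {s b : ℕ}

/-- As long as two sequences agree, their next digits go through the same permutation, so scrambling
preserves the length of the common prefix. -/
theorem scrambleDigits_eq_iff (π : List (Fin b) → Equiv.Perm (Fin b)) (x y : ℕ → Fin b) (K : ℕ) :
    (∀ k < K, scrambleDigits π x k = scrambleDigits π y k) ↔ ∀ k < K, x k = y k := by
  induction K with
  | zero => simp
  | succ K ih =>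
    rw [Nat.forall_lt_succ_right, Nat.forall_lt_succ_right, ih]
    refine and_congr_right fun h => ?_
    rw [scrambleDigits, scrambleDigits, (digitPrefix_eq_iff x y K).2 h, (π _).apply_eq_iff_eq]

/-- The word that is scrambled to the first `k` digits of `c`. -/
def unscramblePrefix (π : List (Fin b) → Equiv.Perm (Fin b)) (c : ℕ → Fin b) : ℕ → List (Fin b)
  | 0 => []
  | k + 1 => unscramblePrefix π c k ++ [(π (unscramblePrefix π c k)).symm (c k)]

theorem scrambleDigits_surjective (π : List (Fin b) → Equiv.Perm (Fin b)) :
    Function.Surjective (scrambleDigits π) := by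
  intro c
  let x : ℕ → Fin b := fun k => (π (unscramblePrefix π c k)).symm (c k)
  have hx : ∀ k, digitPrefix x k = unscramblePrefix π c k := by
    intro k
    induction k with
    | zero => simp [digitPrefix, unscramblePrefix]
    | succ k ih => rw [digitPrefix_succ, ih, unscramblePrefix]
  refine ⟨x, funext fun k => ?_⟩
  rw [scrambleDigits, hx]
  simp [x]

variable [NeZero b]

/-- A scrambled net integrates functions of few digits with an error that is not random. -/
theorem IsNet.sum_scrambleDigits {t m : ℕ} {a : Fin (b ^ m) → Fin s → ℝ} (ha : IsNet b t m s a)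
    (j₀ : Fin s) {κ : Fin s → ℕ} (hκ : ∑ j, κ j + t ≤ m) {ψ : (Fin s → ℕ → Fin b) → ℝ}
    (hψ : DependsBelow κ ψ) (π : Fin s → List (Fin b) → Equiv.Perm (Fin b)) :
    ∑ i, ψ (fun j => scrambleDigits (π j) (Real.digits (a i j) b)) =
      (b : ℝ) ^ (m - ∑ j, κ j) * ∑ c, ψ (extendWord κ c) := by
  set Y : Fin (b ^ m) → Fin s → ℕ → Fin b :=
    fun i j => scrambleDigits (π j) (Real.digits (a i j) b) with hY
  have hcount : ∀ c, (Finset.univ.filter fun i => restrictWord κ (Y i) = c).card =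
      b ^ (m - ∑ j, κ j) := by
    intro c
    -- Pulling the target word back through the scramble turns the count into one for the original
    -- net.
    choose x hx using fun j => scrambleDigits_surjective (π j) (extendWord κ c j)
    rw [show m - ∑ j, κ j = t + (m - t - ∑ j, κ j) by omega,
      ← ha.agreeCount_eq_pow j₀ (κ := κ) (by omega) x, agreeCount]
    congr 1
    ext i
    simp only [Finset.mem_filter, Finset.mem_univ, true_and, restrictWord_eq_iff, ← hx, hY]
    exact forall_congr' fun j => scrambleDigits_eq_iff (π j) _ _ _
  rw [← Finset.sum_fiberwise_of_maps_to (t := Finset.univ) (g := fun i => restrictWord κ (Y i))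
    fun _ _ => Finset.mem_univ _, Finset.mul_sum]
  refine Finset.sum_congr rfl fun c _ => ?_
  have h : ∀ i ∈ Finset.univ.filter (fun i => restrictWord κ (Y i) = c),
      ψ (Y i) = ψ (extendWord κ c) := by
    intro i hi
    rw [← (Finset.mem_filter.1 hi).2, hψ.apply_extendWord]
  rw [Finset.sum_congr rfl h, Finset.sum_const, hcount, nsmul_eq_mul, Nat.cast_pow]

end Scramble

/-! ### Uniform random permutations and the digits of a scramble -/

section Law

variable {s b : ℕ} {Ω : Type*}

/-- Independent uniformly distributed random permutations of `{0, …, b - 1}`, one for each row and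
each word. -/
structure IsUniformPermFamily [MeasurableSpace Ω] (P : Measure Ω)
    (π : Fin s → List (Fin b) → Ω → Equiv.Perm (Fin b)) : Prop where
  measurableSet_eq : ∀ j w σ, MeasurableSet {ω | π j w ω = σ}
  measure_eq : ∀ j w σ, P {ω | π j w ω = σ} = ((Nat.factorial b : ℕ) : ℝ≥0∞)⁻¹
  indep : iIndepFun (m := fun _ => ⊤) (fun q : Fin s × List (Fin b) => π q.1 q.2) P

/-- The scrambled digit array. -/
def scrambleArray (π : Fin s → List (Fin b) → Ω → Equiv.Perm (Fin b)) (x : Fin s → ℕ → Fin b)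
    (ω : Ω) : Fin s → ℕ → Fin b :=
  fun j => scrambleDigits (fun w => π j w ω) (x j)

/-- The array `x` with the digit in row `j` and position `k` replaced by `a`. -/
def setDigit (x : Fin s → ℕ → Fin b) (j : Fin s) (k : ℕ) (a : Fin b) : Fin s → ℕ → Fin b :=
  Function.update x j (Function.update (x j) k a)

theorem setDigit_self (x : Fin s → ℕ → Fin b) (j : Fin s) (k : ℕ) : setDigit x j k (x j k) = x := by
  simp [setDigit]

theorem setDigit_apply (x : Fin s → ℕ → Fin b) (j : Fin s) (k : ℕ) (a : Fin b) (j' : Fin s)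
    (k' : ℕ) : setDigit x j k a j' k' = if j' = j ∧ k' = k then a else x j' k' := by
  by_cases hj : j' = j
  · subst hj
    simp [setDigit, Function.update_apply]
  · simp [setDigit, hj]

theorem card_perm_apply_eq (a a' : Fin b) :
    b * (Finset.univ.filter fun σ : Equiv.Perm (Fin b) => σ a = a').card = b.factorial := by
  have h : ∀ a'', (Finset.univ.filter fun σ : Equiv.Perm (Fin b) => σ a = a'').card =
      (Finset.univ.filter fun σ : Equiv.Perm (Fin b) => σ a = a').card := fun a'' => by
    -- Composing with a transposition of the two targets shows that all targets are hit equally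
    -- often.
    refine Finset.card_equiv (Equiv.mulLeft (Equiv.swap a'' a')) fun σ => ?_
    simp only [Finset.mem_filter, Finset.mem_univ, true_and, Equiv.coe_mulLeft, Equiv.Perm.mul_apply]
    rw [Equiv.swap_apply_eq_iff, Equiv.swap_apply_right]
  have h2 := Finset.card_eq_sum_card_fiberwise (s := (Finset.univ : Finset (Equiv.Perm (Fin b))))
    (f := fun σ => σ a) (t := Finset.univ) (fun _ _ => Finset.mem_coe.2 (Finset.mem_univ _))
  rw [Finset.card_univ, Fintype.card_perm, Fintype.card_fin, Finset.sum_congr rfl fun x _ => h x,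
    Finset.sum_const, Finset.card_univ, Fintype.card_fin, smul_eq_mul] at h2
  exact h2.symm

/-- The information carried by all permutations except the one with index `q₀`. -/
abbrev otherPerms {Ω : Type*} (π : Fin s → List (Fin b) → Ω → Equiv.Perm (Fin b))
    (q₀ : Fin s × List (Fin b)) : MeasurableSpace Ω :=
  ⨆ q ∈ ({q₀}ᶜ : Set (Fin s × List (Fin b))),
    (⊤ : MeasurableSpace (Equiv.Perm (Fin b))).comap (π q.1 q.2)

theorem measurable_scrambleArray_of_ne {π : Fin s → List (Fin b) → Ω → Equiv.Perm (Fin b)}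
    {q₀ : Fin s × List (Fin b)} (x : Fin s → ℕ → Fin b)
    (j : Fin s) (k : ℕ) (h : (j, digitPrefix (x j) k) ≠ q₀) :
    Measurable[otherPerms π q₀]
      fun ω => scrambleArray π x ω j k := by
  refine Measurable.mono
    (ma := (⊤ : MeasurableSpace (Equiv.Perm (Fin b))).comap (π j (digitPrefix (x j) k))) ?_
    (le_iSup₂_of_le (j, digitPrefix (x j) k) h le_rfl) le_rfl
  exact measurable_from_top (f := fun σ : Equiv.Perm (Fin b) => σ (x j k)) |>.comp
    (comap_measurable _)

/-- The permutation at word `w₀` can act only at position `w₀.length` of row `j₀`, and that digit is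
overwritten. -/
theorem measurable_setDigit_scrambleArray {π : Fin s → List (Fin b) → Ω → Equiv.Perm (Fin b)}
    {j₀ : Fin s} {w₀ : List (Fin b)}
    (x : Fin s → ℕ → Fin b) (a : Fin b) :
    Measurable[otherPerms π (j₀, w₀)]
      fun ω => setDigit (scrambleArray π x ω) j₀ w₀.length a := by
  refine @measurable_pi_lambda _ _ _ (_) _ _ fun j => @measurable_pi_lambda _ _ _ (_) _ _ fun k => ?_
  simp_rw [setDigit_apply]
  split_ifs with h
  · exact @measurable_const _ _ (_) (_) a
  · refine measurable_scrambleArray_of_ne x j k fun h' => h ?_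
    rw [Prod.mk.injEq] at h'
    exact ⟨h'.1, by rw [← h'.2, length_digitPrefix]⟩

namespace IsUniformPermFamily

variable [MeasurableSpace Ω] {P : Measure Ω} {π : Fin s → List (Fin b) → Ω → Equiv.Perm (Fin b)}

theorem comap_le (hπ : IsUniformPermFamily P π)
    (q : Fin s × List (Fin b)) :
    (⊤ : MeasurableSpace (Equiv.Perm (Fin b))).comap (π q.1 q.2) ≤ ‹MeasurableSpace Ω› := by
  rintro _ ⟨A, -, rfl⟩
  rw [← Set.biUnion_preimage_singleton]
  exact (Set.toFinite A).measurableSet_biUnion fun σ _ => hπ.measurableSet_eq q.1 q.2 σ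

theorem measurable_apply (hπ : IsUniformPermFamily P π)
    (j : Fin s) (w : List (Fin b)) (a : Fin b) :
    Measurable fun ω => π j w ω a := by
  refine Measurable.mono (ma := (⊤ : MeasurableSpace (Equiv.Perm (Fin b))).comap (π j w)) ?_
    (hπ.comap_le (j, w)) le_rfl
  exact measurable_from_top (f := fun σ : Equiv.Perm (Fin b) => σ a) |>.comp (comap_measurable _)

theorem measurable_scrambleArray (hπ : IsUniformPermFamily P π)
    (x : Fin s → ℕ → Fin b) : Measurable (scrambleArray π x) :=
  measurable_pi_iff.2 fun j => measurable_pi_iff.2 fun k => hπ.measurable_apply j _ (x j k)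

theorem measure_apply_eq (hπ : IsUniformPermFamily P π)
    (hb : b ≠ 0) (j : Fin s) (w : List (Fin b)) (a a' : Fin b) :
    P {ω | π j w ω a = a'} = (b : ℝ≥0∞)⁻¹ := by
  have h1 : {ω | π j w ω a = a'} =
      ⋃ σ ∈ Finset.univ.filter (fun σ : Equiv.Perm (Fin b) => σ a = a'), {ω | π j w ω = σ} := by
    ext ω
    simp
  rw [h1, measure_biUnion_finset (fun σ _ σ' _ h => Set.disjoint_left.2 fun ω h1 h2 =>
      h (h1.symm.trans h2)) fun σ _ => hπ.measurableSet_eq j w σ]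
  simp_rw [hπ.measure_eq]
  rw [Finset.sum_const, ← card_perm_apply_eq a a', nsmul_eq_mul, Nat.cast_mul,
    ENNReal.mul_inv (.inl (by exact_mod_cast hb)) (.inl (ENNReal.natCast_ne_top b)), mul_left_comm]
  have hc : (Finset.univ.filter fun σ : Equiv.Perm (Fin b) => σ a = a').card ≠ 0 := fun h => by
    have := card_perm_apply_eq a a'
    rw [h, mul_zero] at this
    exact b.factorial_ne_zero this.symm
  rw [ENNReal.mul_inv_cancel (by exact_mod_cast hc) (ENNReal.natCast_ne_top _), mul_one]

theorem measure_scrambleArray_eq (hπ : IsUniformPermFamily P π)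
    (hb : b ≠ 0) (x c : Fin s → ℕ → Fin b) (K : ℕ) :
    P {ω | ∀ j, ∀ k < K, scrambleArray π x ω j k = c j k} = (((b : ℝ≥0∞) ^ K)⁻¹) ^ s := by
  -- Distinct positions use distinct permutations, told apart by row and word length, so the
  -- scrambled digits are independent.
  have hinj : Function.Injective fun q : Fin s × Fin K => (q.1, digitPrefix (x q.1) q.2) := by
    rintro ⟨j, k⟩ ⟨j', k'⟩ h
    have h1 := congrArg Prod.fst h
    have h2 := congrArg (fun p => List.length p.2) h
    simp only [length_digitPrefix] at h1 h2
    exact Prod.ext h1 (Fin.ext h2)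
  have hi := hπ.indep.precomp hinj
  have h := hi.meas_iInter
    (s := fun q : Fin s × Fin K => {ω | scrambleArray π x ω q.1 q.2 = c q.1 q.2})
    fun q => ⟨{σ | σ (x q.1 q.2) = c q.1 q.2}, trivial, rfl⟩
  have hset : {ω | ∀ j, ∀ k < K, scrambleArray π x ω j k = c j k} =
      ⋂ q : Fin s × Fin K, {ω | scrambleArray π x ω q.1 q.2 = c q.1 q.2} := by
    ext ω
    simp [Prod.forall, Fin.forall_iff]
  rw [hset, h, Finset.prod_congr rfl fun q _ => hπ.measure_apply_eq hb q.1 _ (x q.1 q.2) _]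
  simp [ENNReal.inv_pow, pow_mul, mul_comm s K]

/-- The scramble of any digit array is uniformly distributed. -/
theorem measurePreserving_scrambleArray (hπ : IsUniformPermFamily P π)
    [NeZero b] [IsProbabilityMeasure P]
    (x : Fin s → ℕ → Fin b) : MeasurePreserving (scrambleArray π x) P (uniformDigits s b) := by
  have hm := hπ.measurable_scrambleArray x
  have := Measure.isProbabilityMeasure_map (μ := P) hm.aemeasurable
  refine ⟨hm, ext_of_restrictWord fun K c => ?_⟩
  rw [Measure.map_apply hm (measurableSet_digits_eq K c), uniformDigits_apply]
  exact hπ.measure_scrambleArray_eq (NeZero.ne b) x c K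

/-- A function that averages to zero over one digit is orthogonal to all functions that do not
involve the permutation of this digit. -/
theorem integral_mul_scrambleArray_eq_zero (hπ : IsUniformPermFamily P π)
    [NeZero b] [IsProbabilityMeasure P] {j₀ : Fin s}
    {k₀ : ℕ} {κ : Fin s → ℕ} {ψ : (Fin s → ℕ → Fin b) → ℝ} (hψ : DependsBelow κ ψ)
    (hzero : ∀ y, ∑ a, ψ (setDigit y j₀ k₀ a) = 0) (x : Fin s → ℕ → Fin b) {h : Ω → ℝ} {C : ℝ}
    (hC : ∀ ω, ‖h ω‖ ≤ C)
    (hh : Measurable[otherPerms π (j₀, digitPrefix (x j₀) k₀)] h) :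
    ∫ ω, h ω * ψ (scrambleArray π x ω) ∂P = 0 := by
  set q₀ : Fin s × List (Fin b) := (j₀, digitPrefix (x j₀) k₀) with hq₀
  have hm'le : otherPerms π q₀ ≤ ‹MeasurableSpace Ω› := iSup₂_le fun q _ => hπ.comap_le q
  let D : Ω → Fin b := fun ω => scrambleArray π x ω j₀ k₀
  let g : Fin b → Ω → ℝ := fun a ω => h ω * ψ (setDigit (scrambleArray π x ω) j₀ k₀ a)
  have hg : ∀ a, Measurable[otherPerms π q₀] (g a) := fun a => by
    have h1 := measurable_setDigit_scrambleArray (π := π) (j₀ := j₀)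
      (w₀ := digitPrefix (x j₀) k₀) x a
    rw [length_digitPrefix] at h1
    exact hh.mul (hψ.measurable.comp h1)
  obtain ⟨C', hC'⟩ := hψ.exists_bound
  have hgb : ∀ a ω, ‖g a ω‖ ≤ C * C' := fun a ω => by
    rw [norm_mul]
    exact mul_le_mul (hC ω) (hC' _) (norm_nonneg _) ((norm_nonneg _).trans (hC ω))
  have hgi : ∀ a, Integrable (g a) P := fun a =>
    Integrable.of_bound ((hg a).mono hm'le le_rfl).aestronglyMeasurable _ (.of_forall (hgb a))
  let e : Fin b → Ω → ℝ := fun a ω => if D ω = a then 1 else 0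
  have hDm : Measurable[(⊤ : MeasurableSpace (Equiv.Perm (Fin b))).comap (π q₀.1 q₀.2)] D :=
    measurable_from_top (f := fun σ : Equiv.Perm (Fin b) => σ (x j₀ k₀)) |>.comp
      (comap_measurable _)
  have hem : ∀ a, Measurable[(⊤ : MeasurableSpace (Equiv.Perm (Fin b))).comap (π q₀.1 q₀.2)] (e a) :=
    fun a => (Measurable.of_discrete (f := fun d : Fin b => if d = a then (1 : ℝ) else 0)).comp hDm
  have hem' : ∀ a, Measurable (e a) := fun a => (hem a).mono (hπ.comap_le q₀) le_rfl
  have hint : ∀ a, ∫ ω, e a ω ∂P = (b : ℝ)⁻¹ := fun a => by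
    have h1 : e a = Set.indicator {ω | D ω = a} 1 := by
      funext ω
      simp [e, Set.indicator_apply]
    have h2 : MeasurableSet {ω | D ω = a} :=
      (hDm.mono (hπ.comap_le q₀) le_rfl) (measurableSet_singleton a)
    rw [h1, integral_indicator_one h2, Measure.real]
    have h3 := hπ.measure_apply_eq (NeZero.ne b) j₀ (digitPrefix (x j₀) k₀) (x j₀ k₀) a
    change (P {ω | π j₀ (digitPrefix (x j₀) k₀) ω (x j₀ k₀) = a}).toReal = _
    rw [h3]
    simp
  -- The digit `D` depends on the permutation `q₀` alone and each `g a` on the others. Since `D` is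
  -- uniform, the integral becomes the mean of the `g a`, whose sum vanishes by `hzero`.
  have hindep := indep_iSup_of_disjoint (fun q => hπ.comap_le q) hπ.indep.iIndep
    (S := {q₀}) (T := {q₀}ᶜ) disjoint_compl_right
  have hprod : ∀ a, ∫ ω, e a ω * g a ω ∂P = (b : ℝ)⁻¹ * ∫ ω, g a ω ∂P := fun a => by
    have hi : IndepFun (e a) (g a) P := by
      rw [IndepFun_iff_Indep]
      refine indep_of_indep_of_le_left (indep_of_indep_of_le_right hindep ?_) ?_
      · exact (hg a).comap_le
      · exact (hem a).comap_le.trans (le_iSup₂_of_le q₀ rfl le_rfl)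
    rw [← hint a]
    exact hi.integral_mul_eq_mul_integral (hem' a).aestronglyMeasurable (hgi a).1
  have hsum : ∀ ω, h ω * ψ (scrambleArray π x ω) = ∑ a, e a ω * g a ω := fun ω => by
    simp only [e, g, ite_mul, one_mul, zero_mul, Finset.sum_ite_eq, Finset.mem_univ, if_true]
    rw [show D ω = scrambleArray π x ω j₀ k₀ from rfl, setDigit_self]
  simp_rw [hsum]
  rw [integral_finsetSum _ fun a _ => ?_]
  · simp_rw [hprod]
    rw [← Finset.mul_sum, ← integral_finsetSum _ fun a _ => hgi a]
    simp only [g, ← Finset.mul_sum, hzero, mul_zero, integral_zero]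
  · refine (hgi a).bdd_mul (c := 1) (hem' a).aestronglyMeasurable (.of_forall fun ω => ?_)
    simp only [e]
    split_ifs <;> simp

/-- Covariances of functions of few digits of two scrambled arrays vanish unless the last digit on
which the second one depends is permuted jointly with one of the relevant digits of the first. -/
theorem integral_mul_eq_zero (hπ : IsUniformPermFamily P π)
    [NeZero b] [IsProbabilityMeasure P] {j₀ : Fin s} {k₀ : ℕ}
    {κ κ' : Fin s → ℕ} {ψ ψ' : (Fin s → ℕ → Fin b) → ℝ} (hψ : DependsBelow κ ψ)
    (hψ' : DependsBelow κ' ψ') (hzero : ∀ y, ∑ a, ψ' (setDigit y j₀ k₀ a) = 0)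
    (x x' : Fin s → ℕ → Fin b)
    (h : κ j₀ ≤ k₀ ∨ digitPrefix (x j₀) k₀ ≠ digitPrefix (x' j₀) k₀) :
    ∫ ω, ψ (scrambleArray π x ω) * ψ' (scrambleArray π x' ω) ∂P = 0 := by
  obtain ⟨C, hC⟩ := hψ.exists_bound
  refine hπ.integral_mul_scrambleArray_eq_zero hψ' hzero x' (fun ω => hC _) ?_
  rcases h with h | h
  -- Here `ψ` does not see position `k₀` of row `j₀`, so that digit may be overwritten by an
  -- arbitrary value such as 0.
  · have h1 := measurable_setDigit_scrambleArray (π := π) (j₀ := j₀)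
      (w₀ := digitPrefix (x' j₀) k₀) x 0
    rw [length_digitPrefix] at h1
    have h2 : (fun ω => ψ (scrambleArray π x ω)) =
        fun ω => ψ (setDigit (scrambleArray π x ω) j₀ k₀ 0) := by
      funext ω
      refine hψ _ _ fun j k hk => ?_
      rw [setDigit_apply, if_neg]
      rintro ⟨rfl, rfl⟩
      omega
    rw [h2]
    exact hψ.measurable.comp h1
  · refine hψ.measurable.comp ?_
    refine @measurable_pi_lambda _ _ _ (_) _ _ fun j =>
      @measurable_pi_lambda _ _ _ (_) _ _ fun k => ?_
    refine measurable_scrambleArray_of_ne x j k fun h' => h ?_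
    rw [Prod.mk.injEq] at h'
    obtain ⟨rfl, h'⟩ := h'
    have hk := congrArg List.length h'
    rw [length_digitPrefix, length_digitPrefix] at hk
    rw [← h', hk]

end IsUniformPermFamily

end Law

/-! ### Decomposition of functions of finitely many digits -/

section Decomposition

variable {s b : ℕ}

/-- The density of the uniform distribution on the sequences that begin with `k` digits of `c`. -/
def agreeKernel (k : ℕ) (c x : ℕ → Fin b) : ℝ := if ∀ i < k, x i = c i then (b : ℝ) ^ k else 0

/-- The increments of `agreeKernel` in the number of digits. -/
def incrementKernel : ℕ → (ℕ → Fin b) → (ℕ → Fin b) → ℝ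
  | 0 => agreeKernel 0
  | k + 1 => fun c x => agreeKernel (k + 1) c x - agreeKernel k c x

theorem sum_incrementKernel (K : ℕ) (c x : ℕ → Fin b) :
    ∑ k ∈ Finset.range (K + 1), incrementKernel k c x = agreeKernel K c x := by
  induction K with
  | zero => simp [incrementKernel]
  | succ K ih => rw [Finset.sum_range_succ, ih, incrementKernel, add_sub_cancel]

theorem agreeKernel_congr {k : ℕ} (c : ℕ → Fin b) {x y : ℕ → Fin b} (h : ∀ i < k, x i = y i) :
    agreeKernel k c x = agreeKernel k c y := by
  rw [agreeKernel, agreeKernel]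
  exact if_congr (forall₂_congr fun i hi => by rw [h i hi]) rfl rfl

theorem incrementKernel_congr {k : ℕ} (c : ℕ → Fin b) {x y : ℕ → Fin b} (h : ∀ i < k, x i = y i) :
    incrementKernel k c x = incrementKernel k c y := by
  cases k with
  | zero => exact agreeKernel_congr c h
  | succ k =>
    simp only [incrementKernel]
    rw [agreeKernel_congr c h, agreeKernel_congr c fun i hi => h i (by omega)]

/-- Averaging the finer density over its last digit gives back the coarser one, so the increments
behave as martingale differences. -/
theorem sum_incrementKernel_update (k : ℕ) (c x : ℕ → Fin b) :
    ∑ a, incrementKernel (k + 1) c (Function.update x k a) = 0 := by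
  have h1 : ∀ a, agreeKernel k c (Function.update x k a) = agreeKernel k c x := fun a =>
    agreeKernel_congr c fun i hi => Function.update_of_ne hi.ne _ _
  have h2 : ∀ a, agreeKernel (k + 1) c (Function.update x k a) =
      if a = c k then b * agreeKernel k c x else 0 := fun a => by
    have : (∀ i < k + 1, Function.update x k a i = c i) ↔ (∀ i < k, x i = c i) ∧ a = c k := by
      rw [Nat.forall_lt_succ_right, Function.update_self]
      exact and_congr_left fun _ => forall₂_congr fun i hi => by
        rw [Function.update_of_ne hi.ne]
    rw [agreeKernel, agreeKernel, if_congr this rfl rfl]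
    by_cases ha : a = c k <;> by_cases hx : ∀ i < k, x i = c i <;> simp [ha, hx, pow_succ']
  simp only [incrementKernel, h1, h2, Finset.sum_sub_distrib, Finset.sum_ite_eq', Finset.mem_univ,
    if_true, Finset.sum_const, Finset.card_univ, Fintype.card_fin, nsmul_eq_mul, sub_self]

variable [NeZero b]

/-- The component of resolution `κ` of a function of `K` digits in each row. -/
noncomputable def resolutionPart (K : ℕ) (F : (Fin s → ℕ → Fin b) → ℝ) (κ : Fin s → ℕ)
    (x : Fin s → ℕ → Fin b) : ℝ :=
  (((b : ℝ) ^ K)⁻¹) ^ s * ∑ c : (Fin s → Fin K → Fin b), F (extendWord (fun _ => K) c) *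
    ∏ j, incrementKernel (κ j) (extendWord (fun _ => K) c j) (x j)

theorem dependsBelow_resolutionPart (K : ℕ) (F : (Fin s → ℕ → Fin b) → ℝ) (κ : Fin s → ℕ) :
    DependsBelow κ (resolutionPart K F κ) := fun x y h => by
  simp only [resolutionPart, fun c j => incrementKernel_congr c (h j)]

theorem sum_resolutionPart_setDigit (K : ℕ) (F : (Fin s → ℕ → Fin b) → ℝ) {κ : Fin s → ℕ}
    {j : Fin s} {k : ℕ} (hk : κ j = k + 1) (x : Fin s → ℕ → Fin b) :
    ∑ a, resolutionPart K F κ (setDigit x j k a) = 0 := by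
  simp only [resolutionPart]
  rw [← Finset.mul_sum, Finset.sum_comm, Finset.sum_eq_zero, mul_zero]
  intro c _
  rw [← Finset.mul_sum, mul_eq_zero]
  right
  simp_rw [← Finset.mul_prod_erase Finset.univ _ (Finset.mem_univ j)]
  have h : ∀ a, ∏ i ∈ Finset.univ.erase j,
      incrementKernel (κ i) (extendWord (fun _ => K) c i) (setDigit x j k a i) =
      ∏ i ∈ Finset.univ.erase j, incrementKernel (κ i) (extendWord (fun _ => K) c i) (x i) :=
    fun a => Finset.prod_congr rfl fun i hi => by
      rw [setDigit, Function.update_of_ne (Finset.ne_of_mem_erase hi)]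
  simp_rw [h, ← Finset.sum_mul, setDigit, Function.update_self, hk, sum_incrementKernel_update,
    zero_mul]

/-- Expanding a product of telescoping sums leaves the product of the finest kernels, which selects
the word of `x` with weight b^(Ks). -/
theorem sum_resolutionPart {K : ℕ} {F : (Fin s → ℕ → Fin b) → ℝ}
    (hF : DependsBelow (fun _ => K) F) (x : Fin s → ℕ → Fin b) :
    ∑ κ ∈ Fintype.piFinset fun _ : Fin s => Finset.range (K + 1), resolutionPart K F κ x = F x := by
  have hb : (b : ℝ) ^ K ≠ 0 := pow_ne_zero _ (Nat.cast_ne_zero.2 (NeZero.ne b))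
  simp only [resolutionPart]
  rw [← Finset.mul_sum, Finset.sum_comm]
  have hprod : ∀ c : Fin s → ℕ → Fin b, ∑ κ ∈ Fintype.piFinset fun _ : Fin s => Finset.range (K + 1),
      ∏ j, incrementKernel (κ j) (c j) (x j) = ∏ j, agreeKernel K (c j) (x j) := fun c => by
    simp_rw [← sum_incrementKernel]
    exact (Finset.prod_univ_sum _ fun j k => incrementKernel k (c j) (x j)).symm
  simp_rw [← Finset.mul_sum, hprod]
  rw [Finset.sum_eq_single (restrictWord (fun _ => K) x)]
  · rw [hF.apply_extendWord, mul_left_comm, Finset.prod_congr rfl fun j _ =>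
      show agreeKernel K _ (x j) = _ from if_pos ((restrictWord_eq_iff (fun _ => K) x _).1 rfl j)]
    simp [hb]
  · intro c _ hc
    obtain ⟨j, hj⟩ := not_forall.1 fun h => hc.symm ((restrictWord_eq_iff (fun _ => K) x c).2 h)
    rw [Finset.prod_eq_zero (Finset.mem_univ j) (if_neg hj), mul_zero]
  · simp

end Decomposition

/-! ### The variance of scrambled net averages of functions of finitely many digits -/

theorem integral_sum_mul_sum {Ω α α' : Type*} [MeasurableSpace Ω] {P : Measure Ω} (T : Finset α)
    (T' : Finset α') {f : α → Ω → ℝ} {g : α' → Ω → ℝ}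
    (h : ∀ a a', Integrable (fun ω => f a ω * g a' ω) P) :
    ∫ ω, (∑ a ∈ T, f a ω) * ∑ a' ∈ T', g a' ω ∂P =
      ∑ a ∈ T, ∑ a' ∈ T', ∫ ω, f a ω * g a' ω ∂P := by
  simp_rw [Finset.sum_mul_sum]
  rw [integral_finsetSum _ fun a _ => integrable_finsetSum _ fun a' _ => h a a']
  exact Finset.sum_congr rfl fun a _ => integral_finsetSum _ fun a' _ => h a a'

section Variance

variable {s b : ℕ} [NeZero b] {Ω : Type*} [MeasurableSpace Ω] {P : Measure Ω}
  [IsProbabilityMeasure P] {π : Fin s → List (Fin b) → Ω → Equiv.Perm (Fin b)}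

namespace IsUniformPermFamily

theorem integrable_mul (hπ : IsUniformPermFamily P π) {κ κ' : Fin s → ℕ}
    {ψ ψ' : (Fin s → ℕ → Fin b) → ℝ} (hψ : DependsBelow κ ψ) (hψ' : DependsBelow κ' ψ')
    (x x' : Fin s → ℕ → Fin b) :
    Integrable (fun ω => ψ (scrambleArray π x ω) * ψ' (scrambleArray π x' ω)) P :=
  (hψ.memLp (hπ.measurable_scrambleArray x) 2).integrable_mul
    (hψ'.memLp (hπ.measurable_scrambleArray x') 2)

theorem integral_sq_eq (hπ : IsUniformPermFamily P π) {κ : Fin s → ℕ}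
    {ψ : (Fin s → ℕ → Fin b) → ℝ} (hψ : DependsBelow κ ψ) (x : Fin s → ℕ → Fin b) :
    ∫ ω, ψ (scrambleArray π x ω) * ψ (scrambleArray π x ω) ∂P =
      ∫ y, ψ y ^ 2 ∂uniformDigits s b := by
  rw [← (hπ.measurePreserving_scrambleArray x).map_eq,
    integral_map (hπ.measurable_scrambleArray x).aemeasurable
      (hψ.measurable.pow_const 2).aestronglyMeasurable]
  simp_rw [sq]

/-- In a row where the resolutions differ, the last digit of the finer part is invisible to the
coarser one. -/
theorem integral_resolutionPart_mul (hπ : IsUniformPermFamily P π) (K : ℕ)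
    (F : (Fin s → ℕ → Fin b) → ℝ) {κ κ' : Fin s → ℕ} (hκ : κ ≠ κ') (x x' : Fin s → ℕ → Fin b) :
    ∫ ω, resolutionPart K F κ (scrambleArray π x ω) *
      resolutionPart K F κ' (scrambleArray π x' ω) ∂P = 0 := by
  obtain ⟨j, hj⟩ := Function.ne_iff.1 hκ
  rcases lt_or_gt_of_ne hj with h | h
  · refine hπ.integral_mul_eq_zero (j₀ := j) (k₀ := κ' j - 1) (dependsBelow_resolutionPart K F κ)
      (dependsBelow_resolutionPart K F κ') (sum_resolutionPart_setDigit K F (by omega)) x x'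
      (.inl (by omega))
  · simp_rw [mul_comm (resolutionPart K F κ _)]
    refine hπ.integral_mul_eq_zero (j₀ := j) (k₀ := κ j - 1) (dependsBelow_resolutionPart K F κ')
      (dependsBelow_resolutionPart K F κ) (sum_resolutionPart_setDigit K F (by omega)) x' x
      (.inl (by omega))

/-- If the points separate before the last relevant digit of some row, those digits are permuted
independently. Otherwise 2uv ≤ u² + v² and uniformity of each scrambled point give the bound. -/
theorem integral_resolutionPart_mul_self_le (hπ : IsUniformPermFamily P π) (K : ℕ)
    (F : (Fin s → ℕ → Fin b) → ℝ) (κ : Fin s → ℕ) (x x' : Fin s → ℕ → Fin b) :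
    ∫ ω, resolutionPart K F κ (scrambleArray π x ω) *
      resolutionPart K F κ (scrambleArray π x' ω) ∂P ≤
      if ∀ j, ∀ k < κ j - 1, x' j k = x j k then
        ∫ y, resolutionPart K F κ y ^ 2 ∂uniformDigits s b else 0 := by
  have hdep := dependsBelow_resolutionPart K F κ
  split_ifs with h
  · have h1 := hπ.integral_sq_eq hdep x
    have h2 := hπ.integral_sq_eq hdep x'
    have i1 := hπ.integrable_mul hdep hdep x x
    have i2 := hπ.integrable_mul hdep hdep x' x'
    calc _ ≤ ∫ ω, 1 / 2 * (resolutionPart K F κ (scrambleArray π x ω) *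
          resolutionPart K F κ (scrambleArray π x ω) +
          resolutionPart K F κ (scrambleArray π x' ω) *
          resolutionPart K F κ (scrambleArray π x' ω)) ∂P := by
          refine integral_mono (hπ.integrable_mul hdep hdep x x') ((i1.add i2).const_mul _)
            fun ω => ?_
          nlinarith [sq_nonneg (resolutionPart K F κ (scrambleArray π x ω) -
            resolutionPart K F κ (scrambleArray π x' ω))]
      _ = _ := by
          rw [integral_const_mul, integral_add i1 i2, h1, h2]
          ring
  · simp only [not_forall] at h
    obtain ⟨j, k, hk, hne⟩ := h
    refine (hπ.integral_mul_eq_zero (j₀ := j) (k₀ := κ j - 1) hdep hdep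
      (sum_resolutionPart_setDigit K F (by omega)) x x' (.inr fun hp => hne ?_)).le
    exact ((digitPrefix_eq_iff _ _ _).1 hp k hk).symm

theorem sum_integral_resolutionPart_sq (hπ : IsUniformPermFamily P π) {K : ℕ}
    {F : (Fin s → ℕ → Fin b) → ℝ} (hF : DependsBelow (fun _ => K) F) :
    ∑ κ ∈ Fintype.piFinset fun _ : Fin s => Finset.range (K + 1),
      ∫ y, resolutionPart K F κ y ^ 2 ∂uniformDigits s b = ∫ y, F y ^ 2 ∂uniformDigits s b := by
  -- The scramble of any fixed array, here all zeros, has the uniform law, so orthogonality under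
  -- `P` yields this Parseval identity.
  rw [← hπ.integral_sq_eq hF fun _ _ => 0]
  simp_rw [← sum_resolutionPart hF (scrambleArray π _ _)]
  rw [integral_sum_mul_sum _ _ fun κ κ' => hπ.integrable_mul (dependsBelow_resolutionPart K F κ)
    (dependsBelow_resolutionPart K F κ') _ _]
  refine Finset.sum_congr rfl fun κ hκ => ?_
  rw [Finset.sum_eq_single_of_mem κ hκ fun κ' _ h =>
    hπ.integral_resolutionPart_mul K F h.symm _ _]
  exact (hπ.integral_sq_eq (dependsBelow_resolutionPart K F κ) _).symm

variable {t m : ℕ} {a : Fin (b ^ m) → Fin s → ℝ}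

theorem integral_sq_sum_resolutionPart_le (hπ : IsUniformPermFamily P π) (ha : IsNet b t m s a)
    (K : ℕ) (F : (Fin s → ℕ → Fin b) → ℝ) {κ : Fin s → ℕ} (hκ : m < ∑ j, κ j + t) :
    ∫ ω, (∑ i, resolutionPart K F κ (scrambleArray π (fun j => Real.digits (a i j) b) ω)) *
      (∑ i, resolutionPart K F κ (scrambleArray π (fun j => Real.digits (a i j) b) ω)) ∂P ≤
      (b : ℝ) ^ m * (b : ℝ) ^ (t + s) * ∫ y, resolutionPart K F κ y ^ 2 ∂uniformDigits s b := by
  have hdep := dependsBelow_resolutionPart K F κ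
  have htm := ha.1
  set N := ∫ y, resolutionPart K F κ y ^ 2 ∂uniformDigits s b
  have hN : 0 ≤ N := integral_nonneg fun y => sq_nonneg _
  obtain ⟨j₀, -, -⟩ : ∃ j ∈ Finset.univ, κ j ≠ 0 :=
    Finset.exists_ne_zero_of_sum_ne_zero (by omega)
  -- Dropping one digit per row costs at most s in total length, hence b^(t+s) instead of b^t.
  have hsum : ∑ j, κ j ≤ ∑ j, (κ j - 1) + s := by
    calc ∑ j, κ j ≤ ∑ j, ((κ j - 1) + 1) := Finset.sum_le_sum fun j _ => by omega
      _ = _ := by simp [Finset.sum_add_distrib]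
  rw [integral_sum_mul_sum _ _ fun i i' => hπ.integrable_mul hdep hdep _ _]
  have hrow : ∀ i, ∑ i', ∫ ω,
      resolutionPart K F κ (scrambleArray π (fun j => Real.digits (a i j) b) ω) *
      resolutionPart K F κ (scrambleArray π (fun j => Real.digits (a i' j) b) ω) ∂P ≤
      (b : ℝ) ^ (t + s) * N := by
    intro i
    refine (Finset.sum_le_sum fun i' _ => hπ.integral_resolutionPart_mul_self_le K F κ _ _).trans ?_
    rw [← Finset.sum_filter, Finset.sum_const, nsmul_eq_mul]
    refine mul_le_mul_of_nonneg_right ?_ hN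
    have := ha.agreeCount_le j₀ (κ := fun j => κ j - 1) (by omega)
      (fun j => Real.digits (a i j) b)
    exact_mod_cast this
  refine (Finset.sum_le_sum fun i _ => hrow i).trans ?_
  simp [mul_assoc]

/-- The variance of a scrambled net sum is at most a constant multiple of that of a sum of
independent uniform points. -/
theorem variance_sum_le (hπ : IsUniformPermFamily P π) (ha : IsNet b t m s a) {K : ℕ}
    {F : (Fin s → ℕ → Fin b) → ℝ} (hF : DependsBelow (fun _ => K) F) :
    variance (fun ω => ∑ i, F (scrambleArray π (fun j => Real.digits (a i j) b) ω)) P ≤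
      (b : ℝ) ^ m * (b : ℝ) ^ (t + s) * ∫ y, F y ^ 2 ∂uniformDigits s b := by
  set Y : Fin (b ^ m) → Ω → Fin s → ℕ → Fin b :=
    fun i => scrambleArray π fun j => Real.digits (a i j) b with hY
  have hYm : ∀ i, Measurable (Y i) := fun i => hπ.measurable_scrambleArray _
  rcases isEmpty_or_nonempty (Fin s) with hs | ⟨⟨j₀⟩⟩
  · have : (fun ω => ∑ i, F (Y i ω)) = fun _ => ∑ _i : Fin (b ^ m), F fun _ _ => 0 := by
      funext ω
      exact Finset.sum_congr rfl fun i _ => congrArg F (Subsingleton.elim _ _)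
    rw [this, variance_eq_integral aemeasurable_const]
    have : 0 ≤ ∫ y, F y ^ 2 ∂uniformDigits s b := integral_nonneg fun y => sq_nonneg _
    simp only [integral_const, probReal_univ, one_smul, sub_self, zero_pow two_ne_zero]
    positivity
  let T := Fintype.piFinset fun _ : Fin s => Finset.range (K + 1)
  let Z : (Fin s → ℕ) → Ω → ℝ := fun κ ω => ∑ i, resolutionPart K F κ (Y i ω)
  have hZ : ∀ κ, MemLp (Z κ) 2 P := fun κ => memLp_finsetSum _ fun i _ =>
    (dependsBelow_resolutionPart K F κ).memLp (hYm i) 2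
  let T₁ := T.filter fun κ => m < ∑ j, κ j + t
  -- The coarse parts have net sums whose value does not involve the permutations.
  have hconst : ∃ C : ℝ, ∀ ω, ∑ κ ∈ T.filter (fun κ => ¬ m < ∑ j, κ j + t), Z κ ω = C :=
    ⟨_, fun ω => Finset.sum_congr rfl fun κ hκ => ha.sum_scrambleDigits j₀
      (not_lt.1 (Finset.mem_filter.1 hκ).2) (dependsBelow_resolutionPart K F κ)
      fun j w => π j w ω⟩
  obtain ⟨C, hC⟩ := hconst
  have hsplit : (fun ω => ∑ i, F (Y i ω)) = fun ω => ∑ κ ∈ T₁, Z κ ω + C := by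
    funext ω
    rw [← hC ω, Finset.sum_filter_add_sum_filter_not, Finset.sum_comm]
    exact Finset.sum_congr rfl fun i _ => (sum_resolutionPart hF _).symm
  have hT₁ : MemLp (fun ω => ∑ κ ∈ T₁, Z κ ω) 2 P := memLp_finsetSum _ fun κ _ => hZ κ
  rw [hsplit, variance_add_const hT₁.1]
  refine (variance_le_expectation_sq hT₁.1).trans ?_
  simp only [Pi.pow_apply, sq]
  have horth : ∀ κ κ', κ ≠ κ' → ∫ ω, Z κ ω * Z κ' ω ∂P = 0 := by
    intro κ κ' h
    rw [integral_sum_mul_sum _ _ fun i i' => hπ.integrable_mul (dependsBelow_resolutionPart K F κ)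
      (dependsBelow_resolutionPart K F κ') _ _]
    exact Finset.sum_eq_zero fun i _ => Finset.sum_eq_zero fun i' _ =>
      hπ.integral_resolutionPart_mul K F h _ _
  rw [integral_sum_mul_sum _ _ fun κ κ' => (hZ κ).integrable_mul (hZ κ')]
  calc ∑ κ ∈ T₁, ∑ κ' ∈ T₁, ∫ ω, Z κ ω * Z κ' ω ∂P
      = ∑ κ ∈ T₁, ∫ ω, Z κ ω * Z κ ω ∂P := Finset.sum_congr rfl fun κ hκ =>
        Finset.sum_eq_single_of_mem κ hκ fun κ' _ h => horth κ κ' h.symm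
    _ ≤ ∑ κ ∈ T₁, (b : ℝ) ^ m * (b : ℝ) ^ (t + s) *
          ∫ y, resolutionPart K F κ y ^ 2 ∂uniformDigits s b := Finset.sum_le_sum fun κ hκ =>
        hπ.integral_sq_sum_resolutionPart_le ha K F (Finset.mem_filter.1 hκ).2
    _ ≤ ∑ κ ∈ T, (b : ℝ) ^ m * (b : ℝ) ^ (t + s) *
          ∫ y, resolutionPart K F κ y ^ 2 ∂uniformDigits s b :=
        Finset.sum_le_sum_of_subset_of_nonneg (Finset.filter_subset _ _) fun κ _ _ =>
          mul_nonneg (by positivity) (integral_nonneg fun y => sq_nonneg _)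
    _ = _ := by
        simp only [sq]
        rw [← Finset.mul_sum]
        congr 1
        simpa only [sq] using hπ.sum_integral_resolutionPart_sq hF

end IsUniformPermFamily

end Variance

/-! ### Approximation by functions of finitely many digits -/

theorem integral_sub_sq_le {Ω : Type*} [MeasurableSpace Ω] {μ : Measure Ω} {f g h : Ω → ℝ}
    (hf : MemLp f 2 μ) (hg : MemLp g 2 μ) (hh : MemLp h 2 μ) :
    ∫ x, (f x - h x) ^ 2 ∂μ ≤ 2 * ∫ x, (f x - g x) ^ 2 ∂μ + 2 * ∫ x, (g x - h x) ^ 2 ∂μ := by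
  have h1 : Integrable (fun x => (f x - g x) ^ 2) μ := (hf.sub hg).integrable_sq
  have h2 : Integrable (fun x => (g x - h x) ^ 2) μ := (hg.sub hh).integrable_sq
  rw [← integral_const_mul, ← integral_const_mul,
    ← integral_add (h1.const_mul 2) (h2.const_mul 2)]
  refine integral_mono (hf.sub hh).integrable_sq ((h1.const_mul 2).add (h2.const_mul 2)) fun x => ?_
  nlinarith [sq_nonneg ((f x - g x) - (g x - h x))]

theorem variance_add_le_two_mul {Ω : Type*} [MeasurableSpace Ω] {P : Measure Ω}
    [IsProbabilityMeasure P] {X Y : Ω → ℝ} (hX : MemLp X 2 P) (hY : MemLp Y 2 P) :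
    variance (fun ω => X ω + Y ω) P ≤ 2 * variance X P + 2 * variance Y P := by
  have h1 := variance_add hX hY
  have h2 := variance_sub hX hY
  have h3 := variance_nonneg (X - Y) P
  have h4 : variance (fun ω => X ω + Y ω) P = variance (X + Y) P := rfl
  linarith

/-- Bounded continuous functions are dense in L², and by dominated convergence such a function is
the L² limit of its values at truncated arrays. -/
theorem exists_dependsBelow_integral_sub_sq_le {s b : ℕ} [NeZero b] (μ : Measure (Fin s → ℕ → Fin b))
    [IsProbabilityMeasure μ] {H : (Fin s → ℕ → Fin b) → ℝ} (hH : MemLp H 2 μ) {ε : ℝ}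
    (hε : 0 < ε) :
    ∃ (K : ℕ) (G : (Fin s → ℕ → Fin b) → ℝ), DependsBelow (fun _ => K) G ∧
      ∫ x, (H x - G x) ^ 2 ∂μ ≤ ε := by
  obtain ⟨g, hg, -⟩ := MemLp.exists_boundedContinuous_integral_rpow_sub_le (p := 2) two_pos
    (by simpa using hH) (show 0 < ε / 4 by positivity)
  simp only [Real.rpow_two, Real.norm_eq_abs, sq_abs] at hg
  let G : ℕ → (Fin s → ℕ → Fin b) → ℝ :=
    fun K x => g (extendWord (fun _ => K) (restrictWord (fun _ => K) x))
  have hG : ∀ K, DependsBelow (fun _ => K) (G K) := fun K =>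
    dependsBelow_comp_restrictWord (fun _ => K) fun c => g (extendWord (fun _ => K) c)
  have hgL : MemLp g 2 μ := MemLp.of_bound g.continuous.measurable.aestronglyMeasurable ‖g‖
    (.of_forall g.norm_coe_le_norm)
  have hGL : ∀ K, MemLp (G K) 2 μ := fun K => (hG K).memLp measurable_id 2
  have hlim : Tendsto (fun K => ∫ x, (g x - G K x) ^ 2 ∂μ) atTop (𝓝 (∫ x, (0 : ℝ) ∂μ)) := by
    refine tendsto_integral_of_dominated_convergence (fun _ => (2 * ‖g‖) ^ 2)
      (fun K => (hgL.sub (hGL K)).integrable_sq.1) (integrable_const _)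
      (fun K => .of_forall fun x => ?_) (.of_forall fun x => ?_)
    · rw [Real.norm_of_nonneg (sq_nonneg _), ← sq_abs]
      refine pow_le_pow_left₀ (abs_nonneg _) ?_ 2
      exact g.dist_le_two_norm _ _
    · have h := (g.continuous.tendsto _).comp (tendsto_extendWord_restrictWord x)
      have h2 := ((tendsto_const_nhds (x := g x)).sub h).pow 2
      simpa using h2
  rw [integral_zero] at hlim
  obtain ⟨K, hK⟩ := (hlim.eventually (gt_mem_nhds (show 0 < ε / 4 by positivity))).exists
  refine ⟨K, G K, hG K, (integral_sub_sq_le hH hgL (hGL K)).trans ?_⟩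
  linarith

/-! ### The variance of scrambled net averages of square integrable functions -/

theorem IsNet.exists_sum_eq_const {s b : ℕ} [NeZero b] {Ω : Type*} {t m : ℕ}
    {a : Fin (b ^ m) → Fin s → ℝ} (ha : IsNet b t m s a) {K : ℕ}
    {G : (Fin s → ℕ → Fin b) → ℝ} (hG : DependsBelow (fun _ => K) G) (hK : s * K + t ≤ m)
    (π : Fin s → List (Fin b) → Ω → Equiv.Perm (Fin b)) :
    ∃ C : ℝ, ∀ ω, ∑ i, G (scrambleArray π (fun j => Real.digits (a i j) b) ω) = C := by
  rcases isEmpty_or_nonempty (Fin s) with hs | ⟨⟨j₀⟩⟩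
  · exact ⟨∑ _i : Fin (b ^ m), G fun _ _ => 0, fun ω =>
      Finset.sum_congr rfl fun i _ => congrArg G (Subsingleton.elim _ _)⟩
  · exact ⟨_, fun ω => ha.sum_scrambleDigits j₀ (by simpa using hK) hG fun j w => π j w ω⟩

namespace IsUniformPermFamily

variable {s b : ℕ} [NeZero b] {Ω : Type*} [MeasurableSpace Ω] {P : Measure Ω}
  [IsProbabilityMeasure P] {π : Fin s → List (Fin b) → Ω → Equiv.Perm (Fin b)}

/-- Cauchy–Schwarz loses a factor n, but needs no net property and no bound on the number of digits.
-/
theorem variance_sum_le_card_sq (hπ : IsUniformPermFamily P π) {n : ℕ}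
    (x : Fin n → Fin s → ℕ → Fin b) {H : (Fin s → ℕ → Fin b) → ℝ}
    (hH : MemLp H 2 (uniformDigits s b)) :
    variance (fun ω => ∑ i, H (scrambleArray π (x i) ω)) P ≤
      (n : ℝ) ^ 2 * ∫ y, H y ^ 2 ∂uniformDigits s b := by
  have hHi : ∀ i, MemLp (fun ω => H (scrambleArray π (x i) ω)) 2 P := fun i =>
    hH.comp_measurePreserving (hπ.measurePreserving_scrambleArray (x i))
  have hsum : MemLp (fun ω => ∑ i, H (scrambleArray π (x i) ω)) 2 P :=
    memLp_finsetSum _ fun i _ => hHi i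
  have hi : ∀ i, ∫ ω, H (scrambleArray π (x i) ω) ^ 2 ∂P = ∫ y, H y ^ 2 ∂uniformDigits s b := by
    intro i
    have hmp := hπ.measurePreserving_scrambleArray (x i)
    rw [← hmp.map_eq, integral_map hmp.measurable.aemeasurable]
    rw [hmp.map_eq]
    exact hH.integrable_sq.1
  refine (variance_le_expectation_sq hsum.1).trans ?_
  calc ∫ ω, ((fun ω => ∑ i, H (scrambleArray π (x i) ω)) ^ 2) ω ∂P
      ≤ ∫ ω, (n : ℝ) * ∑ i, H (scrambleArray π (x i) ω) ^ 2 ∂P := by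
        refine integral_mono hsum.integrable_sq
          ((integrable_finsetSum _ fun i _ => (hHi i).integrable_sq).const_mul _) fun ω => ?_
        simpa using sq_sum_le_card_mul_sum_sq (s := Finset.univ)
          (f := fun i => H (scrambleArray π (x i) ω))
    _ = _ := by
        rw [integral_const_mul, integral_finsetSum _ fun i _ => (hHi i).integrable_sq]
        simp_rw [hi]
        rw [Finset.sum_const, Finset.card_univ, Fintype.card_fin, nsmul_eq_mul]
        ring

variable {t m : ℕ} {a : Fin (b ^ m) → Fin s → ℝ}

/-- If `H` is within mean square `δ` of a function that the net integrates exactly, then the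
scrambled net sum has variance at most a constant times `n δ`. -/
theorem variance_sum_le_of_approx (hπ : IsUniformPermFamily P π) (ha : IsNet b t m s a)
    {H G : (Fin s → ℕ → Fin b) → ℝ} (hH : MemLp H 2 (uniformDigits s b)) {K : ℕ}
    (hG : DependsBelow (fun _ => K) G) (hK : s * K + t ≤ m) {δ : ℝ} (hδ : 0 < δ)
    (hHG : ∫ y, (H y - G y) ^ 2 ∂uniformDigits s b ≤ δ) :
    variance (fun ω => ∑ i, H (scrambleArray π (fun j => Real.digits (a i j) b) ω)) P ≤
      (2 + 8 * (b : ℝ) ^ (t + s)) * ((b : ℝ) ^ m * δ) := by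
  set Y : Fin (b ^ m) → Ω → Fin s → ℕ → Fin b :=
    fun i => scrambleArray π fun j => Real.digits (a i j) b with hY
  have hYm : ∀ i, MeasurePreserving (Y i) P (uniformDigits s b) := fun i =>
    hπ.measurePreserving_scrambleArray _
  have hn : (0 : ℝ) < (b : ℝ) ^ m := pow_pos (Nat.cast_pos.2 (NeZero.pos b)) m
  have hn1 : (1 : ℝ) ≤ (b : ℝ) ^ m := one_le_pow₀ (by exact_mod_cast NeZero.pos b)
  -- The tolerance δ/n absorbs the n² of the crude bound. `K₁` may grow with m without harm, since
  -- the constant in `variance_sum_le` does not depend on the number of digits.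
  obtain ⟨K₁, G₁, hG₁, hHG₁⟩ := exists_dependsBelow_integral_sub_sq_le (uniformDigits s b) hH
    (show 0 < δ / (b : ℝ) ^ m by positivity)
  have hGL : MemLp G 2 (uniformDigits s b) := hG.memLp measurable_id 2
  have hG₁L : MemLp G₁ 2 (uniformDigits s b) := hG₁.memLp measurable_id 2
  have hD : DependsBelow (fun _ => max K K₁) (G₁ - G) :=
    (hG₁.mono fun _ => le_max_right _ _).sub (hG.mono fun _ => le_max_left _ _)
  obtain ⟨C, hC⟩ := ha.exists_sum_eq_const hG hK π
  have hsumL : ∀ {F : (Fin s → ℕ → Fin b) → ℝ}, MemLp F 2 (uniformDigits s b) →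
      MemLp (fun ω => ∑ i, F (Y i ω)) 2 P := fun hF =>
    memLp_finsetSum _ fun i _ => hF.comp_measurePreserving (hYm i)
  have hsplit : (fun ω => ∑ i, H (Y i ω)) =
      fun ω => (∑ i, (H - G₁) (Y i ω)) + (∑ i, (G₁ - G) (Y i ω) + C) := by
    funext ω
    rw [← hC ω]
    simp only [← Finset.sum_add_distrib, Pi.sub_apply]
    exact Finset.sum_congr rfl fun i _ => by ring
  rw [hsplit]
  refine (variance_add_le_two_mul (Y := fun ω => ∑ i, (G₁ - G) (Y i ω) + C) (hsumL (hH.sub hG₁L))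
    ((hsumL (hG₁L.sub hGL)).add (memLp_const C))).trans ?_
  rw [variance_add_const (hsumL (hG₁L.sub hGL)).1]
  have v1 : variance (fun ω => ∑ i, (H - G₁) (Y i ω)) P ≤ (b : ℝ) ^ m * δ := by
    refine (hπ.variance_sum_le_card_sq _ (hH.sub hG₁L)).trans ?_
    calc ((b ^ m : ℕ) : ℝ) ^ 2 * ∫ y, (H - G₁) y ^ 2 ∂uniformDigits s b
        ≤ ((b : ℝ) ^ m) ^ 2 * (δ / (b : ℝ) ^ m) := by
          rw [Nat.cast_pow]
          exact mul_le_mul_of_nonneg_left hHG₁ (by positivity)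
      _ = _ := by field_simp
  -- Passing through `H` gives 2δ/n + 2δ ≤ 4δ; doubling in `variance_add_le_two_mul` makes this the
  -- 8 in the final constant.
  have hint : ∫ y, (G₁ - G) y ^ 2 ∂uniformDigits s b ≤ 4 * δ := by
    refine (integral_sub_sq_le hG₁L hH hGL).trans ?_
    have h1 : ∫ y, (G₁ y - H y) ^ 2 ∂uniformDigits s b =
        ∫ y, (H y - G₁ y) ^ 2 ∂uniformDigits s b := by simp_rw [sub_sq_comm (G₁ _)]
    have h2 : δ / (b : ℝ) ^ m ≤ δ := div_le_self hδ.le hn1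
    linarith
  have v2 : variance (fun ω => ∑ i, (G₁ - G) (Y i ω)) P ≤
      (b : ℝ) ^ m * (b : ℝ) ^ (t + s) * (4 * δ) :=
    (hπ.variance_sum_le ha hD).trans (mul_le_mul_of_nonneg_left hint (by positivity))
  linarith

end IsUniformPermFamily

theorem measurePreserving_transform_pi {s : ℕ} {d : Fin s → ℕ}
    {X : (j : Fin s) → Set (EuclideanSpace ℝ (Fin (d j)))} (hX : ∀ j, volume (X j) = 1)
    {β : Fin s → ℕ} [∀ j, NeZero (β j)] (hβ : ∀ j, 2 ≤ β j)
    {S : (j : Fin s) → RecursiveSplit (d j) (β j) (X j)} (hS : ∀ j, (S j).Convergent) :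
    MeasurePreserving (fun (v : Fin s → ℝ) j => (S j).transform (hS j) (v j))
      (Measure.pi fun _ : Fin s => volume.restrict (Set.Ico (0 : ℝ) 1))
      (volume.restrict (Set.univ.pi X)) := by
  rw [volume_pi, Measure.restrict_pi_pi]
  exact measurePreserving_pi _ _ fun j => (hS j).measurePreserving_transform (hX j) (hβ j)

theorem mainTheorem2 {s : ℕ} (d : Fin s → ℕ)
    (X : (j : Fin s) → Set (EuclideanSpace ℝ (Fin (d j))))
    (hX : ∀ j, volume (X j) = 1)
    -- a convergent recursive split of each set, each in a base of its own
    (β : Fin s → ℕ) [∀ j, NeZero (β j)] (hβ : ∀ j, 2 ≤ β j)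
    (S : (j : Fin s) → RecursiveSplit (d j) (β j) (X j))
    (hS : ∀ j, (S j).Convergent)
    -- nets in base `b` with fixed `t` and `s`, whose sizes `n = b ^ m i` tend to infinity
    (b : ℕ) [NeZero b] (hb : 2 ≤ b) (t : ℕ)
    (m : ℕ → ℕ) (hm : Tendsto m atTop atTop)
    (a : (i : ℕ) → Fin (b ^ m i) → Fin s → ℝ)
    (ha : ∀ i, IsNet b t (m i) s (a i))
    -- their nested uniform scrambles
    {Ω : ℕ → Type*} [∀ i, MeasurableSpace (Ω i)] (P : (i : ℕ) → Measure (Ω i))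
    [∀ i, IsProbabilityMeasure (P i)]
    (u : (i : ℕ) → Fin (b ^ m i) → Ω i → Fin s → ℝ)
    (hu : ∀ i, IsNestedUniformScramble b (P i) (a i) (u i))
    -- a square integrable function on the product of the sets
    (f : ((j : Fin s) → EuclideanSpace ℝ (Fin (d j))) → ℝ)
    (hf : MemLp f 2 (volume.restrict (Set.univ.pi X))) :
    (∀ i, MemLp (fun ω => estimate f (fun j => (S j).transform (hS j)) fun l => u i l ω)
      2 (P i)) ∧
    (fun i => variance
        (fun ω => estimate f (fun j => (S j).transform (hS j)) fun l => u i l ω) (P i))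
      =o[atTop] fun i => 1 / ((b ^ m i : ℕ) : ℝ) := by
  let H : (Fin s → ℕ → Fin b) → ℝ :=
    fun y => f fun j => (S j).transform (hS j) (Real.ofDigits (y j))
  have hH : MemLp H 2 (uniformDigits s b) := hf.comp_measurePreserving
    ((measurePreserving_transform_pi hX hβ hS).comp (measurePreserving_ofDigits hb))
  choose π hπm hπu hπi hπ using hu
  have hfam : ∀ i, IsUniformPermFamily (P i) (π i) := fun i => ⟨hπm i, hπu i, hπi i⟩
  have hest : ∀ i, (fun ω => estimate f (fun j => (S j).transform (hS j)) fun l => u i l ω) =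
      fun ω => (1 / ((b ^ m i : ℕ) : ℝ)) *
        ∑ l, H (scrambleArray (π i) (fun j => Real.digits (a i l j) b) ω) := by
    intro i
    funext ω
    simp only [estimate, hπ]
    rfl
  refine ⟨fun i => ?_, ?_⟩
  · have hl : ∀ l, MemLp (fun ω => H (scrambleArray (π i) (fun j => Real.digits (a i l j) b) ω)) 2
        (P i) := fun l =>
      hH.comp_measurePreserving ((hfam i).measurePreserving_scrambleArray _)
    rw [hest i]
    exact (memLp_finsetSum _ fun l _ => hl l).const_mul _
  rw [isLittleO_iff]
  intro c hc
  set M : ℝ := 2 + 8 * (b : ℝ) ^ (t + s) with hM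
  have hM0 : 0 < M := by positivity
  -- `G` and `K` depend on `c` but not on the net, so s K + t ≤ m holds eventually; `M` is the
  -- constant of `variance_sum_le_of_approx`.
  obtain ⟨K, G, hG, hHG⟩ := exists_dependsBelow_integral_sub_sq_le (uniformDigits s b) hH
    (show 0 < c / M by positivity)
  filter_upwards [hm.eventually_ge_atTop (s * K + t)] with i hi
  have hn : (0 : ℝ) < (b : ℝ) ^ m i := pow_pos (Nat.cast_pos.2 (NeZero.pos b)) _
  rw [hest i, variance_const_mul, Real.norm_of_nonneg (mul_nonneg (sq_nonneg _) (variance_nonneg _ _)),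
    Nat.cast_pow, Real.norm_of_nonneg (by positivity)]
  calc _ ≤ (1 / (b : ℝ) ^ m i) ^ 2 * (M * ((b : ℝ) ^ m i * (c / M))) :=
        mul_le_mul_of_nonneg_left
          ((hfam i).variance_sum_le_of_approx (ha i) hH hG hi (by positivity) hHG) (sq_nonneg _)
    _ = c * (1 / (b : ℝ) ^ m i) := by field_simp
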